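/- A *Jacobi matrix* is a bounded self-adjoint operator $J=J_{a,b}$ on $\ell^2(\mathbb Z)$ given by $(J\varphi)_n=a_{n-1}\varphi_{n-1}+b_n\varphi_n+a_n\varphi_{n+1}$, where $a,b\in\ell^\infty(\mathbb Z,\mathbb R)$ and $\inf_n a_n>0$. It is *$q$-periodic* ($q\in\mathbb Z$, $q\ge 1$) if $a_{n+q}=a_n$ and $b_{n+q}=b_n$ for all $n\in\mathbb Z$. For $R>0$, let $\mathcal J(R)$ be the set of all Jacobi matrices $J_{a,b}$ with $\|J_{a,b}\|\le R$ and $\inf_n a_n\ge R^{-1}$. Let $X$ be the position operator $(X\varphi)_n=n\varphi_n$ with domain $D(X)=\{\varphi\in\ell^2(\mathbb Z):\sum_n|n\varphi_n|^2<\infty\}$, and let $X_J(t)=e^{itJ}Xe^{-itJ}$, $t\in\mathbb R$, be its Heisenberg evolution, defined on $\{\varphi : e^{-itJ}\varphi\in D(X)\}$. **Corollary.** For every $R>0$ there is a constant $C_1=C_1(R)>1$, depending only on $R$, such that the following holds for every $q\ge 1$ and every $q$-periodic $J\in\mathcal J(R)$. The strong limit $$Q_J=\operatorname*{s-lim}_{t\to\infty}\frac1t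 X_J(t)$$ exists on $D(X)$ and defines a bounded self-adjoint operator $Q_J$ on $\ell^2(\mathbb Z)$; and for every $\varphi\in D(X)$ and every $t>0$ one has $\varphi\in\ell^1(\mathbb Z)$, $\varphi\in D(X_J(t))$ and $$\Bigl\|Q_J\varphi-\frac1t X_J(t)\varphi\Bigr\|\le \frac1t\|X\varphi\|+C_1^{\,q}\,\|\varphi\|_1\,t^{-1/5},$$ where $\|\varphi\|_1=\sum_n|\varphi_n|$ is the $\ell^1$ norm. -/

import Mathlib

open Filter Topology
open scoped lp ENNReal

noncomputable section

namespace JacobiTransport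

/-- The Hilbert space `ℓ²(ℤ)` of square-summable complex sequences. -/
abbrev H : Type := ℓ²(ℤ, ℂ)

theorem memlp_shift (k : ℤ) (φ : H) : Memℓp (fun n : ℤ => φ (n + k)) 2 := by
  have h := (memℓp_gen_iff (p := 2) (by norm_num)).1 (lp.memℓp φ)
  exact memℓp_gen ((Equiv.addRight k).summable_iff.2 h)

/-- The translation `(S_k φ)_n = φ_{n+k}`, as a bounded operator on `ℓ²(ℤ)`. -/
def shift (k : ℤ) : H →L[ℂ] H :=
  LinearMap.mkContinuous
    { toFun := fun φ => ⟨fun n => φ (n + k), memlp_shift k φ⟩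
      map_add' := fun φ ψ => by ext n; rfl
      map_smul' := fun c φ => by ext n; simp }
    1 (fun φ => by
      rw [one_mul]
      refine le_of_eq ?_
      rw [lp.norm_eq_tsum_rpow (by norm_num), lp.norm_eq_tsum_rpow (by norm_num)]
      congr 1
      exact (Equiv.addRight k).tsum_eq (fun n : ℤ => ‖φ n‖ ^ (2 : ℝ≥0∞).toReal))

@[simp] theorem shift_apply (k : ℤ) (φ : H) (n : ℤ) : shift k φ n = φ (n + k) := rfl

theorem memlp_mul (c : ℓ^∞(ℤ, ℝ)) (φ : H) : Memℓp (fun n : ℤ => (c n : ℂ) * φ n) 2 := by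
  refine (lp.memℓp (‖c‖ • φ)).mono' (fun n => ?_)
  simp only [norm_mul, Complex.norm_real, lp.coeFn_smul, Pi.smul_apply, norm_smul, norm_norm]
  exact mul_le_mul_of_nonneg_right (lp.norm_apply_le_norm (by simp) c n) (norm_nonneg _)

/-- Multiplication by a bounded real sequence, as a bounded operator on `ℓ²(ℤ)`. -/
def diag (c : ℓ^∞(ℤ, ℝ)) : H →L[ℂ] H :=
  LinearMap.mkContinuous
    { toFun := fun φ => ⟨fun n => (c n : ℂ) * φ n, memlp_mul c φ⟩
      map_add' := fun φ ψ => by ext n; exact mul_add _ _ _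
      map_smul' := fun z φ => by ext n; simp [mul_left_comm] }
    ‖c‖ (fun φ => by
      have h : ‖c‖ * ‖φ‖ = ‖‖c‖ • φ‖ := by rw [norm_smul, norm_norm]
      rw [h]
      refine lp.norm_mono (by norm_num) (fun n => ?_)
      simp only [LinearMap.coe_mk, AddHom.coe_mk, norm_mul, Complex.norm_real, lp.coeFn_smul,
        Pi.smul_apply, norm_smul, norm_norm]
      exact mul_le_mul_of_nonneg_right (lp.norm_apply_le_norm (by simp) c n) (norm_nonneg _))

@[simp] theorem diag_apply (c : ℓ^∞(ℤ, ℝ)) (φ : H) (n : ℤ) :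
    diag c φ n = (c n : ℂ) * φ n := rfl

/-- The Jacobi operator `J_{a,b}` on `ℓ²(ℤ)` with coefficients `a, b ∈ ℓ^∞(ℤ, ℝ)`; it acts by
`(J φ)_n = a_{n-1} φ_{n-1} + b_n φ_n + a_n φ_{n+1}`, see `jacobi_apply`. -/
def jacobi (a b : ℓ^∞(ℤ, ℝ)) : H →L[ℂ] H :=
  (shift (-1)).comp (diag a) + diag b + (diag a).comp (shift 1)

theorem jacobi_apply (a b : ℓ^∞(ℤ, ℝ)) (φ : H) (n : ℤ) :
    jacobi a b φ n = (a (n - 1) : ℂ) * φ (n - 1) + (b n : ℂ) * φ n + (a n : ℂ) * φ (n + 1) := by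
  simp [jacobi, sub_eq_add_neg]

/-- `J_{a,b}` belongs to the class `𝒥(R)`: it is a Jacobi matrix (`inf_n a_n > 0`) with
`‖J_{a,b}‖ ≤ R` and `inf_n a_n ≥ R⁻¹`. -/
structure InClass (R : ℝ) (a b : ℓ^∞(ℤ, ℝ)) : Prop where
  iInf_pos : 0 < ⨅ n : ℤ, a n
  norm_le : ‖jacobi a b‖ ≤ R
  inv_le_iInf : R⁻¹ ≤ ⨅ n : ℤ, a n

/-- `J_{a,b}` is `q`-periodic. -/
def IsPeriodic (q : ℕ) (a b : ℓ^∞(ℤ, ℝ)) : Prop :=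
  0 < q ∧ ∀ n : ℤ, a (n + q) = a n ∧ b (n + q) = b n

/-- The position operator `(X φ)_n = n φ_n` with domain
`D(X) = {φ ∈ ℓ²(ℤ) : ∑ |n φ_n|² < ∞}`. -/
def position : H →ₗ.[ℂ] H where
  domain :=
    { carrier := {φ | Memℓp (fun n : ℤ => (n : ℂ) * φ n) 2}
      add_mem' := fun {φ ψ} hφ hψ => by
        have h := Memℓp.add hφ hψ
        refine (congrArg (fun f : ℤ → ℂ => Memℓp f 2) ?_).mp h
        ext n; simp [mul_add]
      zero_mem' := by
        refine (congrArg (fun f : ℤ → ℂ => Memℓp f 2) ?_).mp (zero_memℓp (E := fun _ : ℤ => ℂ))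
        ext n; simp
      smul_mem' := fun c φ hφ => by
        have h := Memℓp.const_smul hφ c
        refine (congrArg (fun f : ℤ → ℂ => Memℓp f 2) ?_).mp h
        ext n; simp [mul_left_comm] }
  toFun :=
    { toFun := fun φ => ⟨fun n => (n : ℂ) * (φ : H) n, φ.2⟩
      map_add' := fun φ ψ => by ext n; exact mul_add _ _ _
      map_smul' := fun z φ => by ext n; simp [mul_left_comm] }

theorem position_apply (φ : position.domain) (n : ℤ) : position φ n = (n : ℂ) * (φ : H) n := rfl

/-- The unitary group `e^{itJ}`. -/
def evol (J : H →L[ℂ] H) (t : ℝ) : H →L[ℂ] H :=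
  NormedSpace.exp ((Complex.I * (t : ℂ)) • J)

/-- The Heisenberg evolution `X_J(t) = e^{itJ} X e^{-itJ}` of the position operator, with its
natural domain `{φ : e^{-itJ} φ ∈ D(X)}`. -/
def heisenberg (J : H →L[ℂ] H) (t : ℝ) : H →ₗ.[ℂ] H where
  domain := position.domain.comap (evol J (-t) : H →ₗ[ℂ] H)
  toFun :=
    { toFun := fun φ => evol J t (position ⟨evol J (-t) (φ : H), φ.2⟩)
      map_add' := fun φ ψ => by
        rw [← map_add, ← LinearPMap.map_add]
        congr 2
        exact Subtype.ext (map_add (evol J (-t)) (φ : H) (ψ : H))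
      map_smul' := fun z φ => by
        rw [RingHom.id_apply, ← map_smul, ← LinearPMap.map_smul]
        congr 2
        exact Subtype.ext (map_smul (evol J (-t)) z (φ : H)) }

theorem heisenberg_apply (J : H →L[ℂ] H) (t : ℝ) (φ : (heisenberg J t).domain) :
    heisenberg J t φ = evol J t (position ⟨evol J (-t) (φ : H), φ.2⟩) := rfl

/-- `Q` is a bounded self-adjoint operator with `Q = s-lim_{t → ∞} t⁻¹ X_J(t)`, the strong limit
being taken on `D(X)` (on which every `X_J(t)` has to be defined). As `D(X)` is dense in `ℓ²(ℤ)`,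
at most one bounded `Q` has this property. -/
def IsAsymptoticVelocity (J Q : H →L[ℂ] H) : Prop :=
  IsSelfAdjoint Q ∧
    ∀ φ ∈ position.domain, ∃ h : ∀ t : ℝ, φ ∈ (heisenberg J t).domain,
      Tendsto (fun t : ℝ => ((t⁻¹ : ℝ) : ℂ) • heisenberg J t ⟨φ, h t⟩) atTop (𝓝 (Q φ))

open Classical in
/-- The operator `Q_J = s-lim_{t → ∞} t⁻¹ X_J(t)`
(with the value `0` if the strong limit does not exist). -/
def asymptoticVelocity (J : H →L[ℂ] H) : H →L[ℂ] H :=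
  if h : ∃ Q : H →L[ℂ] H, IsAsymptoticVelocity J Q then h.choose else 0

end JacobiTransport

end

open JacobiTransport

/-!
Let `V = i[J, X]` be the velocity. Duhamel's formula gives `t⁻¹ X_J(t) φ = t⁻¹ X φ + T_t φ`, where
`T_t` is the average of `e^{iτJ} V e^{-iτJ}` over `τ ∈ [0, t]`, so everything reduces to the
convergence of `T_t`.

The Bloch transform decomposes `J` and `V` into `q × q` matrices `J(θ)` and `V(θ)`. Two eigenvalues
of `J(θ)` differ by at least a constant times `|sin qθ|`: if they were closer, the Wronskian of the
two Bloch waves would be small, so that the orthogonal eigenvectors would be nearly proportional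
first at the origin and then, by Gronwall, on the whole period. Averaging over `[0, t]` therefore
damps the off-diagonal matrix elements of `V(θ)` in an eigenbasis by `κ / (t |sin qθ|)`, with `κ`
exponential in `q`, and leaves the diagonal ones unchanged.

Hence `‖(T_s(θ) - T_t(θ)) e‖²`, for a basis vector `e` and `s ≥ t`, is at most a multiple of
`1 / (1 + (t/κ sin qθ)²)`, whose integral over `θ` is `O(κ/t)`, and by Parseval
`‖(T_s - T_t) δ_n‖² = O(κ/t)` uniformly in `n`. Since `‖T_t‖ ≤ ‖V‖`, the `T_t` converge strongly,
and the rate `t^{-1/2}` at the unit vectors adds up to the same rate on `ℓ¹`, which contains the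
domain of `X`. For small `t` the bound `‖T_t‖ ≤ ‖V‖` is the better one, and interpolating between
the two gives `t^{-α}` for every `0 ≤ α ≤ 1/2`.
-/

noncomputable section

namespace JacobiTransport

section Propagator

variable {𝔸 : Type*} [NormedRing 𝔸] [NormedAlgebra ℂ 𝔸]

/-- The one-parameter group `e^{itJ}` generated by an element `J` of a Banach algebra; for bounded
operators on `ℓ²(ℤ)` it is `evol`. -/
def propagator (J : 𝔸) (t : ℝ) : 𝔸 :=
  NormedSpace.exp ((Complex.I * (t : ℂ)) • J)

@[simp] theorem propagator_zero (J : 𝔸) : propagator J 0 = 1 := by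
  simp [propagator]

theorem commute_propagator (J : 𝔸) (t : ℝ) : Commute J (propagator J t) :=
  ((Commute.refl J).smul_right _).exp_right

variable [CompleteSpace 𝔸]

theorem hasDerivAt_propagator (J : 𝔸) (t : ℝ) :
    HasDerivAt (propagator J) (Complex.I • (J * propagator J t)) t := by
  have h := (hasDerivAt_exp_smul_const' (𝕂 := ℂ) (Complex.I • J) (t : ℂ)).scomp t
    Complex.ofRealCLM.hasDerivAt
  have smul_comm' (s : ℝ) : (s : ℂ) • (Complex.I • J) = (Complex.I * (s : ℂ)) • J := by
    rw [smul_smul, mul_comm]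
  simp only [Function.comp_def, smul_comm', Complex.ofRealCLM_apply, Complex.ofReal_one, one_smul,
    smul_mul_assoc] at h
  exact h

theorem continuous_propagator (J : 𝔸) : Continuous (propagator J) :=
  continuous_iff_continuousAt.2 fun t => (hasDerivAt_propagator J t).continuousAt

theorem propagator_mul_neg (J : 𝔸) (t : ℝ) : propagator J t * propagator J (-t) = 1 := by
  let : NormedAlgebra ℚ 𝔸 := NormedAlgebra.restrictScalars ℚ ℂ 𝔸
  have hcomm : Commute ((Complex.I * (t : ℂ)) • J) ((Complex.I * ((-t : ℝ) : ℂ)) • J) :=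
    ((Commute.refl J).smul_left _).smul_right _
  rw [propagator, propagator, ← NormedSpace.exp_add_of_commute hcomm]
  simp

/-- The Heisenberg evolution `e^{iτJ} P e^{-iτJ}` of a bounded observable `P`. -/
def conjugated (J P : 𝔸) (τ : ℝ) : 𝔸 :=
  propagator J τ * P * propagator J (-τ)

theorem continuous_conjugated (J P : 𝔸) : Continuous (conjugated J P) :=
  ((continuous_propagator J).mul continuous_const).mul
    ((continuous_propagator J).comp continuous_neg)

/-- The time average `t⁻¹ ∫₀ᵗ e^{iτJ} P e^{-iτJ} dτ` (which is `0` at `t = 0`). -/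
def timeAverage (J P : 𝔸) (t : ℝ) : 𝔸 :=
  t⁻¹ • ∫ τ in (0 : ℝ)..t, conjugated J P τ

end Propagator

section CStarAlgebra

variable {𝔸 : Type*} [NormedRing 𝔸] [NormedAlgebra ℂ 𝔸] [StarRing 𝔸] [CStarRing 𝔸]
  [StarModule ℂ 𝔸] {J P : 𝔸}

theorem star_propagator (hJ : IsSelfAdjoint J) (t : ℝ) :
    star (propagator J t) = propagator J (-t) := by
  rw [propagator, NormedSpace.star_exp, star_smul, hJ.star_eq, propagator]
  simp

theorem isSelfAdjoint_conjugated (hJ : IsSelfAdjoint J) (hP : IsSelfAdjoint P) (τ : ℝ) :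
    IsSelfAdjoint (conjugated J P τ) := by
  rw [conjugated, ← star_propagator hJ]
  exact hP.conjugate _

variable [CompleteSpace 𝔸]

theorem propagator_mem_unitary (hJ : IsSelfAdjoint J) (t : ℝ) :
    propagator J t ∈ unitary 𝔸 := by
  rw [Unitary.mem_iff, star_propagator hJ]
  exact ⟨by simpa using propagator_mul_neg J (-t), propagator_mul_neg J t⟩

theorem norm_conjugated (hJ : IsSelfAdjoint J) (P : 𝔸) (τ : ℝ) : ‖conjugated J P τ‖ = ‖P‖ := by
  rw [conjugated, CStarRing.norm_mul_mem_unitary _ (propagator_mem_unitary hJ _),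
    CStarRing.norm_mem_unitary_mul _ (propagator_mem_unitary hJ _)]

theorem norm_timeAverage_le (hJ : IsSelfAdjoint J) (P : 𝔸) (t : ℝ) :
    ‖timeAverage J P t‖ ≤ ‖P‖ := by
  have hint : ‖∫ τ in (0 : ℝ)..t, conjugated J P τ‖ ≤ ‖P‖ * |t - 0| :=
    intervalIntegral.norm_integral_le_of_norm_le_const fun τ _ => (norm_conjugated hJ P τ).le
  rw [timeAverage, norm_smul, norm_inv, Real.norm_eq_abs]
  rw [sub_zero, mul_comm] at hint
  exact inv_mul_le_of_le_mul₀ (abs_nonneg t) (norm_nonneg P) hint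

theorem isSelfAdjoint_timeAverage (hJ : IsSelfAdjoint J) (hP : IsSelfAdjoint P) (t : ℝ) :
    IsSelfAdjoint (timeAverage J P t) := by
  have hint : star (∫ τ in (0 : ℝ)..t, conjugated J P τ) = ∫ τ in (0 : ℝ)..t, conjugated J P τ := by
    rw [← starL'_apply (R := ℝ), ← ContinuousLinearEquiv.coe_coe,
      ← ContinuousLinearMap.intervalIntegral_comp_comm _
        ((continuous_conjugated J P).intervalIntegrable _ _)]
    exact intervalIntegral.integral_congr fun τ _ => isSelfAdjoint_conjugated hJ hP τ
  rw [IsSelfAdjoint, timeAverage, star_smul, hint, star_trivial]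

end CStarAlgebra

section Intertwining

variable {E F : Type*} [NormedAddCommGroup E] [NormedSpace ℂ E] [CompleteSpace E]
  [NormedAddCommGroup F] [NormedSpace ℂ F] [CompleteSpace F]

theorem hasSum_exp_apply (A : E →L[ℂ] E) (x : E) :
    HasSum (fun n : ℕ => ((n.factorial : ℂ)⁻¹) • (A ^ n) x) (NormedSpace.exp A x) := by
  simpa only [map_smul, ContinuousLinearMap.apply_apply] using
    (NormedSpace.exp_series_hasSum_exp' (𝕂 := ℂ) A).mapL (ContinuousLinearMap.apply ℂ E x)

theorem semiconj_exp {A : E →L[ℂ] E} {B : F →L[ℂ] F} {L : E →L[ℂ] F}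
    (h : Function.Semiconj L A B) :
    Function.Semiconj L ⇑(NormedSpace.exp A) ⇑(NormedSpace.exp B) := by
  have hpow (n : ℕ) (x : E) : L ((A ^ n) x) = (B ^ n) (L x) := by
    simpa only [FunLike.coe_pow_eq_iterate] using h.iterate_right n x
  intro x
  have hL := L.hasSum (hasSum_exp_apply A x)
  simp only [map_smul, hpow] at hL
  exact hL.unique (hasSum_exp_apply B (L x))

theorem semiconj_propagator {A : E →L[ℂ] E} {B : F →L[ℂ] F} {L : E →L[ℂ] F}
    (h : Function.Semiconj L A B) (t : ℝ) :
    Function.Semiconj L ⇑(propagator A t) ⇑(propagator B t) :=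
  semiconj_exp fun x => by simp [h x]

theorem propagator_mem_of_invariant {A : E →L[ℂ] E} {S : Submodule ℂ E}
    (hS : IsClosed (S : Set E)) (hA : ∀ x ∈ S, A x ∈ S) (t : ℝ) {x : E} (hx : x ∈ S) :
    propagator A t x ∈ S := by
  have : CompleteSpace S := hS.completeSpace_coe
  let restriction : S →L[ℂ] S := (A ∘L S.subtypeL).codRestrict S fun y => hA y y.2
  have hsemi : Function.Semiconj S.subtypeL restriction A := fun y => rfl
  exact semiconj_propagator hsemi t ⟨x, hx⟩ ▸ Subtype.prop _

theorem propagator_eigenvector {J : E →L[ℂ] E} {c : ℂ} {x : E} (h : J x = c • x) (t : ℝ) :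
    propagator J t x = Complex.exp (Complex.I * t * c) • x := by
  have hsemi : Function.Semiconj (ContinuousLinearMap.toSpanSingleton ℂ x)
      ⇑(algebraMap ℂ (ℂ →L[ℂ] ℂ) c) J := fun z => by
    simp [h, mul_smul, smul_comm c z]
  have hexp := semiconj_propagator hsemi t 1
  rw [propagator, Algebra.smul_def, ← map_mul, ← NormedSpace.algebraMap_exp_comm,
    ← Complex.exp_eq_exp_ℂ] at hexp
  simpa using hexp.symm

theorem continuous_conjugated_apply (J P : E →L[ℂ] E) (x : E) :
    Continuous fun τ => conjugated J P τ x :=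
  (continuous_conjugated J P).clm_apply continuous_const

theorem timeAverage_apply (J P : E →L[ℂ] E) (t : ℝ) (x : E) :
    timeAverage J P t x = t⁻¹ • ∫ τ in (0 : ℝ)..t, conjugated J P τ x := by
  rw [timeAverage, smul_apply,
    ContinuousLinearMap.intervalIntegral_apply ((continuous_conjugated J P).intervalIntegrable _ _)]

theorem semiconj_timeAverage {J P : E →L[ℂ] E} {J' P' : F →L[ℂ] F} {L : E →L[ℂ] F}
    (hJ : Function.Semiconj L J J') (hP : Function.Semiconj L P P') (t : ℝ) :
    Function.Semiconj L ⇑(timeAverage J P t) ⇑(timeAverage J' P' t) := by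
  have hconj (τ : ℝ) : Function.Semiconj L ⇑(conjugated J P τ) ⇑(conjugated J' P' τ) :=
    ((semiconj_propagator hJ τ).comp_right hP).comp_right (semiconj_propagator hJ (-τ))
  intro x
  simp only [timeAverage_apply, L.map_smul_of_tower,
    ← L.intervalIntegral_comp_comm ((continuous_conjugated_apply J P x).intervalIntegrable 0 t),
    (hconj _).eq]

end Intertwining

section HeisenbergEvolution

variable {E : Type*} [NormedAddCommGroup E] [NormedSpace ℂ E]

theorem hasDerivAt_complex_clm_apply {F : Type*} [NormedAddCommGroup F] [NormedSpace ℂ F]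
    {c : ℝ → E →L[ℂ] F} {c' : E →L[ℂ] F} {u : ℝ → E} {u' : E} {t : ℝ}
    (hc : HasDerivAt c c' t) (hu : HasDerivAt u u' t) :
    HasDerivAt (fun s => c s (u s)) (c' (u t) + c t u') t :=
  ((ContinuousLinearMap.restrictScalarsL ℂ E F ℝ ℝ).hasFDerivAt.comp_hasDerivAt t hc).clm_apply hu

/-- The operator `(x, y) ↦ (J x, J y - K x)` on `E × E`. It preserves the graph of an operator `T`
precisely when `J` preserves the domain of `T` and `[J, T] = K` there. -/
def graphAction (J K : E →L[ℂ] E) : E × E →L[ℂ] E × E :=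
  (J ∘L ContinuousLinearMap.fst ℂ E E).prod
    (J ∘L ContinuousLinearMap.snd ℂ E E - K ∘L ContinuousLinearMap.fst ℂ E E)

theorem graphAction_apply (J K : E →L[ℂ] E) (p : E × E) :
    graphAction J K p = (J p.1, J p.2 - K p.1) := rfl

variable [CompleteSpace E]

theorem propagator_graphAction_fst (J K : E →L[ℂ] E) (t : ℝ) (p : E × E) :
    (propagator (graphAction J K) t p).1 = propagator J t p.1 :=
  semiconj_propagator (L := ContinuousLinearMap.fst ℂ E E) (fun _ => rfl) t p

theorem hasDerivAt_propagator_graphAction_snd (J K : E →L[ℂ] E) (p : E × E) (t : ℝ) :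
    HasDerivAt (fun s => propagator J s (propagator (graphAction J K) (-s) p).2)
      (conjugated J (Complex.I • K) t p.1) t := by
  have hgraph : HasDerivAt (fun s => propagator (graphAction J K) (-s) p)
      (-(Complex.I • graphAction J K (propagator (graphAction J K) (-t) p))) t := by
    have hneg := (hasDerivAt_propagator (graphAction J K) (-t)).scomp t (hasDerivAt_neg t)
    exact (hasDerivAt_complex_clm_apply hneg (hasDerivAt_const t p)).congr_deriv (by simp)
  refine (hasDerivAt_complex_clm_apply (hasDerivAt_propagator J t) hgraph.snd).congr_deriv ?_
  have hcomm (y : E) : J (propagator J t y) = propagator J t (J y) :=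
    DFunLike.congr_fun (commute_propagator J t).eq y
  simp [graphAction_apply, conjugated, propagator_graphAction_fst, hcomm, smul_sub]

theorem propagator_mem_graph {T : E →ₗ.[ℂ] E} (hT : T.IsClosed) {J K : E →L[ℂ] E}
    (hJ : ∀ p ∈ T.graph, graphAction J K p ∈ T.graph) {p : E × E} (hp : p ∈ T.graph) (t : ℝ) :
    (propagator J (-t) p.1,
      propagator J (-t) (p.2 + ∫ τ in (0 : ℝ)..t, conjugated J (Complex.I • K) τ p.1))
        ∈ T.graph := by
  have hint := intervalIntegral.integral_eq_sub_of_hasDerivAt (a := 0) (b := t)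
    (fun s _ => hasDerivAt_propagator_graphAction_snd J K p s)
    ((continuous_conjugated_apply J (Complex.I • K) p.1).intervalIntegrable _ _)
  have hinv : propagator J (-t) * propagator J t = 1 := by simpa using propagator_mul_neg J (-t)
  have hsnd : propagator J (-t) (p.2 + ∫ τ in (0 : ℝ)..t, conjugated J (Complex.I • K) τ p.1)
      = (propagator (graphAction J K) (-t) p).2 := by
    rw [hint]
    simpa using DFunLike.congr_fun hinv (propagator (graphAction J K) (-t) p).2
  rw [hsnd, ← propagator_graphAction_fst J K]
  exact propagator_mem_of_invariant hT hJ (-t) hp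

end HeisenbergEvolution

section JacobiForm

variable {𝔸 : Type*} [NormedRing 𝔸]

/-- The algebraic shape `S⁻¹ A + B + A S` of a Jacobi operator with translation `S`, whose inverse
is passed separately as `S'`, and coefficients `A`, `B`. It is used for `jacobi` on `ℓ²(ℤ)`, for its
restriction to `ℓ¹(ℤ)` and for its Bloch fibres. -/
def jacobiForm (S S' A B : 𝔸) : 𝔸 :=
  S' * A + B + A * S

theorem norm_jacobiForm_le {S S' : 𝔸} (hS : ‖S‖ ≤ 1) (hS' : ‖S'‖ ≤ 1) (A B : 𝔸) :
    ‖jacobiForm S S' A B‖ ≤ 2 * ‖A‖ + ‖B‖ := by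
  have hSA := norm_mul_le_of_le hS' (le_refl ‖A‖)
  have hAS := norm_mul_le_of_le (le_refl ‖A‖) hS
  rw [jacobiForm]
  linarith [norm_add₃_le (a := S' * A) (b := B) (c := A * S)]

variable [NormedAlgebra ℂ 𝔸]

/-- The velocity `i[J, X] = i(A S - S⁻¹ A)` of `J = jacobiForm S S' A B`, where `X` is the position
operator, so that `[S, X] = S`. -/
def velocityForm (S S' A : 𝔸) : 𝔸 :=
  Complex.I • (A * S - S' * A)

theorem norm_velocityForm_le {S S' : 𝔸} (hS : ‖S‖ ≤ 1) (hS' : ‖S'‖ ≤ 1) (A : 𝔸) :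
    ‖velocityForm S S' A‖ ≤ 2 * ‖A‖ := by
  have hSA := norm_mul_le_of_le hS' (le_refl ‖A‖)
  have hAS := norm_mul_le_of_le (le_refl ‖A‖) hS
  rw [velocityForm, norm_smul, Complex.norm_I, one_mul]
  linarith [norm_sub_le (A * S) (S' * A)]

section Star

variable [StarRing 𝔸] {S S' A B : 𝔸}

omit [NormedAlgebra ℂ 𝔸] in
theorem isSelfAdjoint_jacobiForm (hS : star S = S') (hA : IsSelfAdjoint A) (hB : IsSelfAdjoint B) :
    IsSelfAdjoint (jacobiForm S S' A B) := by
  subst hS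
  simp only [IsSelfAdjoint, jacobiForm, star_add, star_mul, star_star, hA.star_eq, hB.star_eq]
  abel

theorem isSelfAdjoint_velocityForm [StarModule ℂ 𝔸] (hS : star S = S') (hA : IsSelfAdjoint A) :
    IsSelfAdjoint (velocityForm S S' A) := by
  subst hS
  simp only [IsSelfAdjoint, velocityForm, star_smul, star_sub, star_mul, star_star, hA.star_eq,
    RCLike.star_def, Complex.conj_I]
  rw [neg_smul, ← smul_neg, neg_sub]

end Star

section Semiconj

variable {E F : Type*} [NormedAddCommGroup E] [NormedSpace ℂ E]
  [NormedAddCommGroup F] [NormedSpace ℂ F] {L : E →L[ℂ] F}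
  {S S' A B : E →L[ℂ] E} {T T' C D : F →L[ℂ] F}

theorem semiconj_jacobiForm (hS : Function.Semiconj L S T) (hS' : Function.Semiconj L S' T')
    (hA : Function.Semiconj L A C) (hB : Function.Semiconj L B D) :
    Function.Semiconj L ⇑(jacobiForm S S' A B) ⇑(jacobiForm T T' C D) := fun x => by
  simp [jacobiForm, hS.eq, hS'.eq, hA.eq, hB.eq]

theorem semiconj_velocityForm (hS : Function.Semiconj L S T) (hS' : Function.Semiconj L S' T')
    (hA : Function.Semiconj L A C) :
    Function.Semiconj L ⇑(velocityForm S S' A) ⇑(velocityForm T T' C) := fun x => by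
  simp [velocityForm, hS.eq, hS'.eq, hA.eq]

end Semiconj

end JacobiForm

section JacobiOperator

open scoped InnerProductSpace

theorem star_shift (k : ℤ) : star (shift k) = shift (-k) := by
  rw [ContinuousLinearMap.star_eq_adjoint, eq_comm, ContinuousLinearMap.eq_adjoint_iff]
  intro x y
  rw [lp.inner_eq_tsum, lp.inner_eq_tsum, ← (Equiv.addRight k).tsum_eq]
  simp

theorem isSelfAdjoint_diag (c : ℓ^∞(ℤ, ℝ)) : IsSelfAdjoint (diag c) := by
  rw [IsSelfAdjoint, ContinuousLinearMap.star_eq_adjoint, eq_comm,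
    ContinuousLinearMap.eq_adjoint_iff]
  intro x y
  rw [lp.inner_eq_tsum, lp.inner_eq_tsum]
  refine tsum_congr fun n => ?_
  simp only [diag_apply, RCLike.inner_apply, map_mul, Complex.conj_ofReal]
  ring

theorem norm_shift_le (k : ℤ) : ‖shift k‖ ≤ 1 :=
  LinearMap.mkContinuous_norm_le _ zero_le_one _

theorem norm_diag_le (c : ℓ^∞(ℤ, ℝ)) : ‖diag c‖ ≤ ‖c‖ :=
  LinearMap.mkContinuous_norm_le _ (norm_nonneg c) _

theorem isSelfAdjoint_jacobi (a b : ℓ^∞(ℤ, ℝ)) : IsSelfAdjoint (jacobi a b) :=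
  isSelfAdjoint_jacobiForm (star_shift 1) (isSelfAdjoint_diag a) (isSelfAdjoint_diag b)

/-- The velocity operator `i[J_{a,b}, X]` on `ℓ²(ℤ)`, which does not depend on `b`. -/
def velocity (a : ℓ^∞(ℤ, ℝ)) : H →L[ℂ] H :=
  velocityForm (shift 1) (shift (-1)) (diag a)

theorem isSelfAdjoint_velocity (a : ℓ^∞(ℤ, ℝ)) : IsSelfAdjoint (velocity a) :=
  isSelfAdjoint_velocityForm (star_shift 1) (isSelfAdjoint_diag a)

theorem norm_velocity_le (a : ℓ^∞(ℤ, ℝ)) : ‖velocity a‖ ≤ 2 * ‖a‖ :=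
  (norm_velocityForm_le (norm_shift_le 1) (norm_shift_le (-1)) (diag a)).trans <|
    mul_le_mul_of_nonneg_left (norm_diag_le a) zero_le_two

theorem mem_graph_position {p : H × H} :
    p ∈ position.graph ↔ ∀ n : ℤ, p.2 n = (n : ℂ) * p.1 n := by
  rw [LinearPMap.mem_graph_iff]
  constructor
  · rintro ⟨φ, hφ, hp⟩ n
    rw [← hφ, ← hp, position_apply]
  · intro hp
    have hmem : p.1 ∈ position.domain := by
      have hp_memℓp := lp.memℓp p.2
      rwa [funext hp] at hp_memℓp
    exact ⟨⟨p.1, hmem⟩, rfl, lp.ext (funext fun n => (hp n).symm)⟩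

theorem isClosed_position : position.IsClosed := by
  have hcoord (n : ℤ) : Continuous fun φ : H => φ n :=
    (lp.evalCLM ℂ (fun _ : ℤ => ℂ) 2 n).continuous
  have hgraph : (position.graph : Set (H × H)) = ⋂ n : ℤ, {p | p.2 n = (n : ℂ) * p.1 n} := by
    ext p
    simp only [SetLike.mem_coe, mem_graph_position, Set.mem_iInter, Set.mem_ofPred_eq]
  rw [LinearPMap.IsClosed, hgraph]
  exact isClosed_iInter fun n => isClosed_eq ((hcoord n).comp continuous_snd)
    (continuous_const.mul ((hcoord n).comp continuous_fst))

theorem graphAction_mem_graph_position (a b : ℓ^∞(ℤ, ℝ)) {p : H × H} (hp : p ∈ position.graph) :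
    graphAction (jacobi a b) (diag a * shift 1 - shift (-1) * diag a) p ∈ position.graph := by
  rw [mem_graph_position] at hp ⊢
  intro n
  simp only [graphAction_apply, jacobi_apply, lp.coeFn_sub, Pi.sub_apply, sub_apply,
    mul_apply_eq_comp, diag_apply, shift_apply, hp, ← sub_eq_add_neg]
  push_cast
  ring

theorem heisenberg_eq_position_add_timeAverage (a b : ℓ^∞(ℤ, ℝ)) (φ : position.domain) (t : ℝ) :
    ∃ ht : (φ : H) ∈ (heisenberg (jacobi a b) t).domain,
      ((t⁻¹ : ℝ) : ℂ) • heisenberg (jacobi a b) t ⟨φ, ht⟩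
        = ((t⁻¹ : ℝ) : ℂ) • position φ + timeAverage (jacobi a b) (velocity a) t φ := by
  set J := jacobi a b
  set y : H := position φ + ∫ τ in (0 : ℝ)..t, conjugated J (velocity a) τ φ with hy
  have hgraph : (evol J (-t) φ, evol J (-t) y) ∈ position.graph :=
    propagator_mem_graph isClosed_position (fun _ hp => graphAction_mem_graph_position a b hp)
      (position.mem_graph φ) t
  have ht : evol J (-t) φ ∈ position.domain := LinearPMap.mem_domain_of_mem_graph hgraph
  have hposition : position ⟨evol J (-t) φ, ht⟩ = evol J (-t) y :=
    position.mem_graph_snd_inj (position.mem_graph ⟨_, ht⟩) hgraph rfl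
  have hinv : evol J t (evol J (-t) y) = y := DFunLike.congr_fun (propagator_mul_neg J t) y
  refine ⟨ht, ?_⟩
  rw [heisenberg_apply, hposition, hinv, hy, smul_add, timeAverage_apply]
  rfl

end JacobiOperator

section SummableSequences

variable {ι F : Type*} [NormedAddCommGroup F]

theorem summable_norm_lpOne (ψ : ℓ¹(ι, F)) : Summable fun n => ‖ψ n‖ := by
  simpa using ψ.2.summable

theorem norm_lpOne (ψ : ℓ¹(ι, F)) : ‖ψ‖ = ∑' n, ‖ψ n‖ := by
  rw [lp.norm_eq_tsum_rpow (by norm_num)]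
  simp

variable [NormedSpace ℂ F] {w : ι → F} {C : ℝ}

theorem norm_smul_le_of_bounded (hw : ∀ n, ‖w n‖ ≤ C) (z : ℂ) (n : ι) : ‖z • w n‖ ≤ C * ‖z‖ := by
  rw [norm_smul, mul_comm]
  exact mul_le_mul_of_nonneg_right (hw n) (norm_nonneg z)

theorem summable_norm_smul_of_bounded (hw : ∀ n, ‖w n‖ ≤ C) (ψ : ℓ¹(ι, ℂ)) :
    Summable fun n => ‖ψ n • w n‖ :=
  ((summable_norm_lpOne ψ).mul_left C).of_nonneg_of_le (fun _ => norm_nonneg _) fun n =>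
    norm_smul_le_of_bounded hw (ψ n) n

theorem norm_tsum_smul_le_of_bounded (hw : ∀ n, ‖w n‖ ≤ C) (ψ : ℓ¹(ι, ℂ)) :
    ‖∑' n, ψ n • w n‖ ≤ C * ‖ψ‖ := by
  rw [norm_lpOne, ← tsum_mul_left]
  exact (norm_tsum_le_tsum_norm (summable_norm_smul_of_bounded hw ψ)).trans <|
    (summable_norm_smul_of_bounded hw ψ).tsum_le_tsum
      (fun n => norm_smul_le_of_bounded hw (ψ n) n) ((summable_norm_lpOne ψ).mul_left C)

variable [CompleteSpace F]

/-- The bounded operator `ψ ↦ ∑ ψ_n w_n` on `ℓ¹` defined by a bounded family `w`. -/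
def lpOneLift (hw : ∀ n, ‖w n‖ ≤ C) : ℓ¹(ι, ℂ) →L[ℂ] F :=
  LinearMap.mkContinuous
    { toFun := fun ψ => ∑' n, ψ n • w n
      map_add' := fun ψ χ => by
        rw [← (summable_norm_smul_of_bounded hw ψ).of_norm.tsum_add
          (summable_norm_smul_of_bounded hw χ).of_norm]
        simp [add_smul]
      map_smul' := fun z ψ => by
        rw [RingHom.id_apply, ← (summable_norm_smul_of_bounded hw ψ).of_norm.tsum_const_smul]
        simp [mul_smul] }
    C (norm_tsum_smul_le_of_bounded hw)

theorem lpOneLift_apply (hw : ∀ n, ‖w n‖ ≤ C) (ψ : ℓ¹(ι, ℂ)) :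
    lpOneLift hw ψ = ∑' n, ψ n • w n := rfl

theorem norm_lpOneLift_apply_le (hw : ∀ n, ‖w n‖ ≤ C) (ψ : ℓ¹(ι, ℂ)) :
    ‖lpOneLift hw ψ‖ ≤ C * ‖ψ‖ :=
  norm_tsum_smul_le_of_bounded hw ψ

variable [DecidableEq ι]

@[simp] theorem lpOneLift_single (hw : ∀ n, ‖w n‖ ≤ C) (n : ι) :
    lpOneLift hw (lp.single 1 n 1) = w n := by
  rw [lpOneLift_apply, tsum_eq_single n fun m hm => by rw [lp.single_apply_ne 1 n _ hm, zero_smul],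
    lp.single_apply_self, one_smul]

omit [CompleteSpace F] in
theorem lpOne_ext {f g : ℓ¹(ι, ℂ) →L[ℂ] F}
    (h : ∀ n, f (lp.single 1 n 1) = g (lp.single 1 n 1)) : f = g :=
  lp.ext_continuousLinearMap ENNReal.one_ne_top fun n => ContinuousLinearMap.ext_ring (h n)

omit [CompleteSpace F] in
theorem semiconj_of_single {L : ℓ¹(ι, ℂ) →L[ℂ] F} {A : ℓ¹(ι, ℂ) →L[ℂ] ℓ¹(ι, ℂ)} {B : F →L[ℂ] F}
    (h : ∀ n, L (A (lp.single 1 n 1)) = B (L (lp.single 1 n 1))) : Function.Semiconj L A B :=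
  DFunLike.congr_fun (lpOne_ext (f := L ∘L A) (g := B ∘L L) h)

end SummableSequences

section SummableJacobi

/-- The translation `(S_k ψ)_n = ψ_{n+k}` on `ℓ¹(ℤ)`. -/
def shiftL1 (k : ℤ) : ℓ¹(ℤ, ℂ) →L[ℂ] ℓ¹(ℤ, ℂ) :=
  lpOneLift (w := fun n => lp.single 1 (n - k) 1) (C := 1) fun n => by simp [lp.norm_single]

/-- Multiplication by a bounded real sequence on `ℓ¹(ℤ)`. -/
def diagL1 (c : ℓ^∞(ℤ, ℝ)) : ℓ¹(ℤ, ℂ) →L[ℂ] ℓ¹(ℤ, ℂ) :=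
  lpOneLift (w := fun n => (c n : ℂ) • lp.single 1 n 1) (C := ‖c‖) fun n => by
    rw [norm_smul, lp.norm_single one_pos, norm_one, mul_one, Complex.norm_real]
    exact lp.norm_apply_le_norm ENNReal.top_ne_zero c n

/-- The Jacobi operator `J_{a,b}` on `ℓ¹(ℤ)`. -/
def jacobiL1 (a b : ℓ^∞(ℤ, ℝ)) : ℓ¹(ℤ, ℂ) →L[ℂ] ℓ¹(ℤ, ℂ) :=
  jacobiForm (shiftL1 1) (shiftL1 (-1)) (diagL1 a) (diagL1 b)

/-- The velocity operator `i[J_{a,b}, X]` on `ℓ¹(ℤ)`. -/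
def velocityL1 (a : ℓ^∞(ℤ, ℝ)) : ℓ¹(ℤ, ℂ) →L[ℂ] ℓ¹(ℤ, ℂ) :=
  velocityForm (shiftL1 1) (shiftL1 (-1)) (diagL1 a)

/-- The inclusion of `ℓ¹(ℤ)` into `ℓ²(ℤ)`. -/
def inclusion : ℓ¹(ℤ, ℂ) →L[ℂ] H :=
  lpOneLift (w := fun n => lp.single 2 n 1) (C := 1) fun n => by simp [lp.norm_single]

theorem inclusion_single (n : ℤ) : inclusion (lp.single 1 n 1) = lp.single 2 n 1 :=
  lpOneLift_single _ n

theorem inclusion_apply (ψ : ℓ¹(ℤ, ℂ)) (n : ℤ) : inclusion ψ n = ψ n := by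
  have hcoord : lp.evalCLM ℂ (fun _ : ℤ => ℂ) 2 n ∘L inclusion
      = lp.evalCLM ℂ (fun _ : ℤ => ℂ) 1 n :=
    lpOne_ext fun m => by
      simp [inclusion_single, lp.evalCLM, lp.single_apply]
  exact DFunLike.congr_fun hcoord ψ

theorem semiconj_inclusion_shift (k : ℤ) : Function.Semiconj inclusion (shiftL1 k) (shift k) :=
  semiconj_of_single fun n => by
    ext m
    simp [shiftL1, inclusion_single, lp.single_apply, Pi.single_apply, eq_sub_iff_add_eq]

theorem semiconj_inclusion_diag (c : ℓ^∞(ℤ, ℝ)) :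
    Function.Semiconj inclusion (diagL1 c) (diag c) :=
  semiconj_of_single fun n => by
    ext m
    obtain rfl | hm := eq_or_ne m n <;> simp [diagL1, inclusion_single, lp.single_apply, *]

theorem semiconj_inclusion_jacobi (a b : ℓ^∞(ℤ, ℝ)) :
    Function.Semiconj inclusion (jacobiL1 a b) (jacobi a b) :=
  semiconj_jacobiForm (semiconj_inclusion_shift 1) (semiconj_inclusion_shift (-1))
    (semiconj_inclusion_diag a) (semiconj_inclusion_diag b)

theorem semiconj_inclusion_velocity (a : ℓ^∞(ℤ, ℝ)) :
    Function.Semiconj inclusion (velocityL1 a) (velocity a) :=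
  semiconj_velocityForm (semiconj_inclusion_shift 1) (semiconj_inclusion_shift (-1))
    (semiconj_inclusion_diag a)

end SummableJacobi

section SpectralGap

open ComplexConjugate

/-- Coefficients of a Jacobi matrix with `R⁻¹ ≤ a ≤ R` and `|b| ≤ R`. The index type is `ℤ` on the
lattice and `ZMod q` for one period. -/
structure HasBounds {ι : Type*} (R : ℝ) (a b : ι → ℝ) : Prop where
  one_le : 1 ≤ R
  inv_le : ∀ n, R⁻¹ ≤ a n
  le : ∀ n, a n ≤ R
  abs_le : ∀ n, |b n| ≤ R

namespace HasBounds

variable {ι : Type*} {R : ℝ} {a b : ι → ℝ}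

theorem pos (h : HasBounds R a b) : 0 < R := zero_lt_one.trans_le h.one_le

theorem abs_of_coeff (h : HasBounds R a b) (n : ι) : |a n| = a n :=
  abs_of_nonneg ((inv_nonneg.2 h.pos.le).trans (h.inv_le n))

theorem abs_coeff_le (h : HasBounds R a b) (n : ι) : |a n| ≤ R :=
  (h.abs_of_coeff n).trans_le (h.le n)

theorem comp (h : HasBounds R a b) {κ : Type*} (f : κ → ι) : HasBounds R (a ∘ f) (b ∘ f) :=
  ⟨h.one_le, fun n => h.inv_le (f n), fun n => h.le (f n), fun n => h.abs_le (f n)⟩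

end HasBounds

/-- The sequence `(J_{a,b} - c) w`. -/
def residual (a b : ℤ → ℝ) (c : ℝ) (w : ℤ → ℂ) (n : ℤ) : ℂ :=
  (a (n - 1) : ℂ) * w (n - 1) + (b n : ℂ) * w n + (a n : ℂ) * w (n + 1) - (c : ℂ) * w n

section Growth

variable {R : ℝ} {a b : ℤ → ℝ} (h : HasBounds R a b) {c : ℝ} (hc : |c| ≤ 3 * R) {w : ℤ → ℂ} {ε : ℝ}

include h hc

theorem norm_succ_le_of_residual {n : ℤ} (hw : ‖residual a b c w n‖ ≤ 2 * ε) :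
    ‖w (n + 1)‖ ≤ R * (2 * ε + 4 * R * ‖w n‖ + R * ‖w (n - 1)‖) := by
  have hsolve : (a n : ℂ) * w (n + 1)
      = residual a b c w n + ((c : ℂ) * w n - (b n : ℂ) * w n) - (a (n - 1) : ℂ) * w (n - 1) := by
    rw [residual]
    ring
  have hcw : ‖(c : ℂ) * w n‖ ≤ 3 * R * ‖w n‖ := by
    rw [norm_mul, Complex.norm_real]
    exact mul_le_mul_of_nonneg_right hc (norm_nonneg _)
  have hbw : ‖(b n : ℂ) * w n‖ ≤ R * ‖w n‖ := by
    rw [norm_mul, Complex.norm_real]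
    exact mul_le_mul_of_nonneg_right (h.abs_le n) (norm_nonneg _)
  have haw : ‖(a (n - 1) : ℂ) * w (n - 1)‖ ≤ R * ‖w (n - 1)‖ := by
    rw [norm_mul, Complex.norm_real]
    exact mul_le_mul_of_nonneg_right (h.abs_coeff_le _) (norm_nonneg _)
  have hupper : ‖(a n : ℂ) * w (n + 1)‖ ≤ 2 * ε + 4 * R * ‖w n‖ + R * ‖w (n - 1)‖ := by
    rw [hsolve]
    linarith [norm_sub_le (residual a b c w n + ((c : ℂ) * w n - (b n : ℂ) * w n))
        ((a (n - 1) : ℂ) * w (n - 1)),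
      norm_add_le (residual a b c w n) ((c : ℂ) * w n - (b n : ℂ) * w n),
      norm_sub_le ((c : ℂ) * w n) ((b n : ℂ) * w n)]
  have hlower : R⁻¹ * ‖w (n + 1)‖ ≤ ‖(a n : ℂ) * w (n + 1)‖ := by
    rw [norm_mul, Complex.norm_real, Real.norm_eq_abs, h.abs_of_coeff]
    exact mul_le_mul_of_nonneg_right (h.inv_le n) (norm_nonneg _)
  exact (inv_mul_le_iff₀ h.pos).1 (hlower.trans hupper)

theorem norm_add_norm_succ_le (hε : 0 ≤ ε) {n : ℤ} (hw : ‖residual a b c w n‖ ≤ 2 * ε) :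
    ‖w n‖ + ‖w (n + 1)‖ + ε ≤ 8 * R ^ 2 * (‖w (n - 1)‖ + ‖w n‖ + ε) := by
  have hsucc := norm_succ_le_of_residual h hc hw
  have hR := h.one_le
  have hRR : R ≤ R ^ 2 := by nlinarith
  linarith [mul_le_mul_of_nonneg_right hRR hε, mul_le_mul_of_nonneg_right (hR.trans hRR) hε,
    mul_le_mul_of_nonneg_right (hR.trans hRR) (norm_nonneg (w n)), norm_nonneg (w n),
    mul_nonneg (sq_nonneg R) (norm_nonneg (w (n - 1)))]

theorem norm_le_pow_mul_of_residual (hε : 0 ≤ ε) {q : ℕ}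
    (hw : ∀ n < q, ‖residual a b c w n‖ ≤ 2 * ε) {n : ℕ} (hn : n < q) :
    ‖w n‖ ≤ (8 * R ^ 2) ^ q * (‖w (-1)‖ + ‖w 0‖ + ε) := by
  have hgrowth : ∀ n ≤ q, ‖w ((n : ℤ) - 1)‖ + ‖w n‖ + ε
      ≤ (8 * R ^ 2) ^ n * (‖w (-1)‖ + ‖w 0‖ + ε) := by
    intro n hn
    induction n with
    | zero => simp
    | succ n ih =>
      have hstep := norm_add_norm_succ_le h hc hε (hw n hn)
      rw [pow_succ', mul_assoc, Nat.cast_succ, add_sub_cancel_right]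
      exact hstep.trans (mul_le_mul_of_nonneg_left (ih (Nat.le_of_succ_le hn)) (by positivity))
  have hbase : 1 ≤ 8 * R ^ 2 := by nlinarith [h.one_le]
  calc ‖w n‖ ≤ ‖w ((n : ℤ) - 1)‖ + ‖w n‖ + ε := by linarith [norm_nonneg (w ((n : ℤ) - 1))]
    _ ≤ (8 * R ^ 2) ^ n * (‖w (-1)‖ + ‖w 0‖ + ε) := hgrowth n hn.le
    _ ≤ (8 * R ^ 2) ^ q * (‖w (-1)‖ + ‖w 0‖ + ε) :=
      mul_le_mul_of_nonneg_right (pow_le_pow_right₀ hbase hn.le) (by positivity)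

end Growth

/-- A solution of `J_{a,b} u = c u` on `ℤ` which is multiplied by `ζ` under translation by `q` and
normalized in `ℓ²` of a period. -/
structure IsBlochSolution (q : ℕ) (a b : ℤ → ℝ) (ζ : ℂ) (c : ℝ) (u : ℤ → ℂ) : Prop where
  residual_eq_zero : ∀ n, residual a b c u n = 0
  add_period : ∀ n, u (n + q) = ζ * u n
  sum_norm_sq : ∑ n ∈ Finset.range q, ‖u n‖ ^ 2 = 1

namespace IsBlochSolution

variable {q : ℕ} {a b : ℤ → ℝ} {ζ : ℂ} {c : ℝ} {u : ℤ → ℂ} (hu : IsBlochSolution q a b ζ c u)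

include hu

theorem period_pos : 0 < q := by
  refine Nat.pos_of_ne_zero ?_
  rintro rfl
  simpa using hu.sum_norm_sq

theorem norm_le_one {n : ℕ} (hn : n < q) : ‖u n‖ ≤ 1 := by
  rw [← sq_le_one_iff₀ (norm_nonneg _), ← hu.sum_norm_sq]
  exact Finset.single_le_sum (f := fun n : ℕ => ‖u n‖ ^ 2) (fun _ _ => sq_nonneg _)
    (Finset.mem_range.2 hn)

theorem norm_zero_le_one : ‖u 0‖ ≤ 1 := hu.norm_le_one hu.period_pos

theorem norm_neg_one_le_one (hζ : ‖ζ‖ = 1) : ‖u (-1)‖ ≤ 1 := by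
  have hlast := hu.norm_le_one (Nat.sub_one_lt hu.period_pos.ne')
  rwa [Nat.cast_sub hu.period_pos, Nat.cast_one, sub_eq_neg_add, hu.add_period, norm_mul, hζ,
    one_mul] at hlast

end IsBlochSolution

/-- The Casorati determinant `v_n u_{n+1} - v_{n+1} u_n`. -/
def casoratian (u v : ℤ → ℂ) (n : ℤ) : ℂ := v n * u (n + 1) - v (n + 1) * u n

/-- The Wronskian `a_n (v_n u_{n+1} - v_{n+1} u_n)` of two solutions of the Jacobi equation. -/
def wronskian (a : ℤ → ℝ) (u v : ℤ → ℂ) (n : ℤ) : ℂ := (a n : ℂ) * casoratian u v n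

section Wronskian

variable {q : ℕ} {R : ℝ} {a b : ℤ → ℝ} {ζ : ℂ} {l m : ℝ} {u v : ℤ → ℂ}

theorem wronskian_sub_wronskian {n : ℤ} (hu : residual a b l u n = 0)
    (hv : residual a b m v n = 0) :
    wronskian a u v n - wronskian a u v (n - 1) = ((l : ℂ) - m) * (v n * u n) := by
  rw [residual] at hu hv
  simp only [wronskian, casoratian, sub_add_cancel]
  linear_combination v n * hu - u n * hv

theorem wronskian_add_period (ha : ∀ n, a (n + q) = a n) (hu : ∀ n, u (n + q) = ζ * u n)
    (hv : ∀ n, v (n + q) = ζ * v n) (n : ℤ) :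
    wronskian a u v (n + q) = ζ ^ 2 * wronskian a u v n := by
  rw [wronskian, wronskian, casoratian, casoratian, add_right_comm, ha, hu, hv, hu, hv]
  ring

variable (hu : IsBlochSolution q a b ζ l u) (hv : IsBlochSolution q a b ζ m v)

include hu hv

theorem norm_sum_mul_le_one : ‖∑ n ∈ Finset.range q, v n * u n‖ ≤ 1 := by
  have hterm : ∀ n ∈ Finset.range q, ‖v n * u n‖ ≤ (‖v n‖ ^ 2 + ‖u n‖ ^ 2) / 2 := fun n _ => by
    rw [norm_mul]
    linarith [two_mul_le_add_sq ‖v n‖ ‖u n‖]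
  refine (norm_sum_le_of_le _ hterm).trans_eq ?_
  rw [← Finset.sum_div, Finset.sum_add_distrib, hu.sum_norm_sq, hv.sum_norm_sq]
  norm_num

theorem norm_sq_sub_one_mul_wronskian_le (ha : ∀ n, a (n + q) = a n) :
    ‖ζ ^ 2 - 1‖ * ‖wronskian a u v (-1)‖ ≤ |l - m| := by
  have htelescope : wronskian a u v (-1 + q) - wronskian a u v (-1)
      = ((l : ℂ) - m) * ∑ n ∈ Finset.range q, v n * u n := by
    have hsum := Finset.sum_range_sub (fun n : ℕ => wronskian a u v ((n : ℤ) - 1)) q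
    simp only [Nat.cast_add, Nat.cast_one, add_sub_cancel_right, Nat.cast_zero, zero_sub,
      wronskian_sub_wronskian (hu.residual_eq_zero _) (hv.residual_eq_zero _)] at hsum
    rw [Finset.mul_sum, hsum, neg_add_eq_sub]
  rw [← norm_mul, sub_mul, one_mul, ← wronskian_add_period ha hu.add_period hv.add_period,
    htelescope, norm_mul, ← Complex.ofReal_sub, Complex.norm_real, Real.norm_eq_abs]
  exact mul_le_of_le_one_right (abs_nonneg _) (norm_sum_mul_le_one hu hv)

theorem norm_sq_sub_one_mul_casoratian_le (h : HasBounds R a b) (ha : ∀ n, a (n + q) = a n) :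
    ‖ζ ^ 2 - 1‖ * ‖casoratian u v (-1)‖ ≤ R * |l - m| := by
  have hlower : R⁻¹ * ‖casoratian u v (-1)‖ ≤ ‖wronskian a u v (-1)‖ := by
    rw [wronskian, norm_mul, Complex.norm_real, Real.norm_eq_abs, h.abs_of_coeff]
    exact mul_le_mul_of_nonneg_right (h.inv_le _) (norm_nonneg _)
  rw [← inv_mul_le_iff₀ h.pos, mul_left_comm]
  exact (mul_le_mul_of_nonneg_left hlower (norm_nonneg _)).trans
    (norm_sq_sub_one_mul_wronskian_le hu hv ha)

end Wronskian

/-- The squared norm of the initial data `(u₋₁, u₀)`. -/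
def initialNormSq (u : ℤ → ℂ) : ℝ := ‖u (-1)‖ ^ 2 + ‖u 0‖ ^ 2

/-- The inner product of the initial data `(u₋₁, u₀)` and `(v₋₁, v₀)`. -/
def initialInner (u v : ℤ → ℂ) : ℂ := conj (u (-1)) * v (-1) + conj (u 0) * v 0

/-- The combination `‖U‖² v - ⟪U, V⟫ u`, where `U`, `V` are the initial data of `u`, `v`. Its own
initial data are those of `v` projected off `U`, up to a factor. -/
def transversal (u v : ℤ → ℂ) (n : ℤ) : ℂ := (initialNormSq u : ℂ) * v n - initialInner u v * u n

theorem ofReal_initialNormSq (u : ℤ → ℂ) :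
    (initialNormSq u : ℂ) = conj (u (-1)) * u (-1) + conj (u 0) * u 0 := by
  rw [Complex.conj_mul', Complex.conj_mul', initialNormSq]
  push_cast
  rfl

theorem transversal_neg_one (u v : ℤ → ℂ) :
    transversal u v (-1) = conj (u 0) * casoratian u v (-1) := by
  rw [transversal, ofReal_initialNormSq, initialInner, casoratian, neg_add_cancel]
  ring

theorem transversal_zero (u v : ℤ → ℂ) :
    transversal u v 0 = -conj (u (-1)) * casoratian u v (-1) := by
  rw [transversal, ofReal_initialNormSq, initialInner, casoratian, neg_add_cancel]
  ring

theorem residual_transversal {a b : ℤ → ℝ} {l m : ℝ} {u v : ℤ → ℂ} {n : ℤ}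
    (hu : residual a b l u n = 0) (hv : residual a b m v n = 0) :
    residual a b m (transversal u v) n = -initialInner u v * (((l - m : ℝ) : ℂ) * u n) := by
  simp only [residual, transversal] at *
  push_cast
  linear_combination (initialNormSq u : ℂ) * hv - initialInner u v * hu

section Gap

variable {q : ℕ} {R : ℝ} {a b : ℤ → ℝ} {ζ : ℂ} {l m : ℝ} {u v : ℤ → ℂ}

theorem one_le_initialNormSq (h : HasBounds R a b) (hl : |l| ≤ 3 * R)
    (hu : IsBlochSolution q a b ζ l u) :
    1 ≤ q * (((8 * R ^ 2) ^ q) ^ 2 * (2 * initialNormSq u)) := by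
  have hterm : ∀ n ∈ Finset.range q,
      ‖u n‖ ^ 2 ≤ ((8 * R ^ 2) ^ q) ^ 2 * (2 * initialNormSq u) := fun n hn => by
    have hgrowth := norm_le_pow_mul_of_residual h hl le_rfl
      (fun k _ => by rw [hu.residual_eq_zero, norm_zero, mul_zero]) (Finset.mem_range.1 hn)
    refine (pow_le_pow_left₀ (norm_nonneg _) hgrowth 2).trans ?_
    rw [mul_pow, add_zero]
    exact mul_le_mul_of_nonneg_left add_sq_le (sq_nonneg _)
  simpa [hu.sum_norm_sq] using Finset.sum_le_sum hterm

variable (hu : IsBlochSolution q a b ζ l u) (hv : IsBlochSolution q a b ζ m v)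

include hu hv

theorem norm_initialInner_le (hζ : ‖ζ‖ = 1) : ‖initialInner u v‖ ≤ 2 := by
  refine (norm_add_le _ _).trans ?_
  rw [norm_mul, norm_mul, RCLike.norm_conj, RCLike.norm_conj]
  linarith [mul_le_one₀ (hu.norm_neg_one_le_one hζ) (norm_nonneg _) (hv.norm_neg_one_le_one hζ),
    mul_le_one₀ hu.norm_zero_le_one (norm_nonneg _) hv.norm_zero_le_one]

theorem norm_transversal_le (h : HasBounds R a b) (hm : |m| ≤ 3 * R) (hζ : ‖ζ‖ = 1) {n : ℕ}
    (hn : n < q) :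
    ‖transversal u v n‖ ≤ (8 * R ^ 2) ^ q * (2 * ‖casoratian u v (-1)‖ + |l - m|) := by
  have hneg_one : ‖transversal u v (-1)‖ ≤ ‖casoratian u v (-1)‖ := by
    rw [transversal_neg_one, norm_mul, RCLike.norm_conj]
    exact mul_le_of_le_one_left (norm_nonneg _) hu.norm_zero_le_one
  have hzero : ‖transversal u v 0‖ ≤ ‖casoratian u v (-1)‖ := by
    rw [transversal_zero, norm_mul, norm_neg, RCLike.norm_conj]
    exact mul_le_of_le_one_left (norm_nonneg _) (hu.norm_neg_one_le_one hζ)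
  have hresidual : ∀ k < q, ‖residual a b m (transversal u v) k‖ ≤ 2 * |l - m| := fun k hk => by
    rw [residual_transversal (hu.residual_eq_zero k) (hv.residual_eq_zero k), norm_mul, norm_neg,
      norm_mul, Complex.norm_real, Real.norm_eq_abs]
    exact mul_le_mul (norm_initialInner_le hu hv hζ)
      (mul_le_of_le_one_right (abs_nonneg _) (hu.norm_le_one hk)) (by positivity) zero_le_two
  refine (norm_le_pow_mul_of_residual h hm (abs_nonneg _) hresidual hn).trans ?_
  exact mul_le_mul_of_nonneg_left (by linarith) (by positivity)

theorem initialNormSq_le_of_orthogonal (h : HasBounds R a b) (hm : |m| ≤ 3 * R) (hζ : ‖ζ‖ = 1)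
    (huv : ∑ n ∈ Finset.range q, conj (v n) * u n = 0) :
    initialNormSq u ≤ q * ((8 * R ^ 2) ^ q * (2 * ‖casoratian u v (-1)‖ + |l - m|)) := by
  have hsum : ∑ n ∈ Finset.range q, conj (v n) * transversal u v n = initialNormSq u := by
    have hterm (n : ℕ) : conj (v n) * transversal u v n
        = (initialNormSq u : ℂ) * ((‖v n‖ ^ 2 : ℝ) : ℂ)
          - initialInner u v * (conj (v n) * u n) := by
      push_cast
      rw [← Complex.conj_mul', transversal]
      ring
    simp only [hterm]
    rw [Finset.sum_sub_distrib, ← Finset.mul_sum, ← Finset.mul_sum, huv, ← Complex.ofReal_sum,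
      hv.sum_norm_sq, Complex.ofReal_one, mul_one, mul_zero, sub_zero]
  have hbound : ∀ n ∈ Finset.range q, ‖conj (v n) * transversal u v n‖
      ≤ (8 * R ^ 2) ^ q * (2 * ‖casoratian u v (-1)‖ + |l - m|) := fun n hn => by
    rw [norm_mul, RCLike.norm_conj]
    exact (mul_le_of_le_one_left (norm_nonneg _) (hv.norm_le_one (Finset.mem_range.1 hn))).trans
      (norm_transversal_le hu hv h hm hζ (Finset.mem_range.1 hn))
  have hnorm := norm_sum_le_of_le _ hbound
  rw [hsum, Complex.norm_real, Finset.sum_const, Finset.card_range, nsmul_eq_mul] at hnorm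
  exact (le_abs_self _).trans hnorm

end Gap

/-- The reciprocal of the lower bound for the gaps between the energies of Bloch solutions, in units
of `|ζ² - 1|`. -/
def gapConstant (R : ℝ) (q : ℕ) : ℝ := 8 * R * q ^ 2 * (8 * R ^ 2) ^ (3 * q)

/-- If the energies are close, so are `u` and a multiple of `v` near the origin, hence on the whole
period, and the two solutions cannot be orthogonal. -/
theorem norm_sq_sub_one_le_gapConstant_mul {q : ℕ} {R : ℝ} {a b : ℤ → ℝ} {ζ : ℂ} {l m : ℝ}
    {u v : ℤ → ℂ} (h : HasBounds R a b) (ha : ∀ n, a (n + q) = a n) (hζ : ‖ζ‖ = 1)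
    (hl : |l| ≤ 3 * R) (hm : |m| ≤ 3 * R) (hu : IsBlochSolution q a b ζ l u)
    (hv : IsBlochSolution q a b ζ m v) (huv : ∑ n ∈ Finset.range q, conj (v n) * u n = 0) :
    ‖ζ ^ 2 - 1‖ ≤ gapConstant R q * |l - m| := by
  set B : ℝ := (8 * R ^ 2) ^ q with hB
  set e : ℝ := 2 * ‖casoratian u v (-1)‖ + |l - m| with he
  have hR := h.one_le
  have hζ_sq : ‖ζ ^ 2 - 1‖ ≤ 2 := by
    refine (norm_sub_le _ _).trans ?_
    rw [norm_pow, hζ]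
    norm_num
  have hZe : ‖ζ ^ 2 - 1‖ * e ≤ 4 * R * |l - m| := by
    rw [he]
    linarith [norm_sq_sub_one_mul_casoratian_le hu hv h ha,
      mul_le_mul_of_nonneg_right hζ_sq (abs_nonneg (l - m)),
      mul_le_mul_of_nonneg_right hR (abs_nonneg (l - m))]
  have hone : 1 ≤ 2 * q ^ 2 * B ^ 3 * e :=
    calc 1 ≤ q * (B ^ 2 * (2 * initialNormSq u)) := one_le_initialNormSq h hl hu
      _ ≤ q * (B ^ 2 * (2 * (q * (B * e)))) := by
        gcongr
        exact initialNormSq_le_of_orthogonal hu hv h hm hζ huv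
      _ = 2 * q ^ 2 * B ^ 3 * e := by ring
  calc ‖ζ ^ 2 - 1‖ ≤ ‖ζ ^ 2 - 1‖ * (2 * q ^ 2 * B ^ 3 * e) :=
        le_mul_of_one_le_right (norm_nonneg _) hone
    _ = 2 * q ^ 2 * B ^ 3 * (‖ζ ^ 2 - 1‖ * e) := by ring
    _ ≤ 2 * q ^ 2 * B ^ 3 * (4 * R * |l - m|) := mul_le_mul_of_nonneg_left hZe (by positivity)
    _ = gapConstant R q * |l - m| := by rw [gapConstant, hB]; ring

end SpectralGap

section Fiber

open ComplexConjugate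
open scoped InnerProductSpace Matrix.Norms.L2Operator

/-- The unit complex number `e^{iθ}`. -/
def phase (θ : ℝ) : ℂ := Complex.exp (Complex.I * θ)

@[simp] theorem phase_zero : phase 0 = 1 := by simp [phase]

@[simp] theorem norm_phase (θ : ℝ) : ‖phase θ‖ = 1 := Complex.norm_exp_I_mul_ofReal θ

theorem phase_add (θ η : ℝ) : phase (θ + η) = phase θ * phase η := by
  rw [phase, phase, phase, ← Complex.exp_add, Complex.ofReal_add, mul_add]

theorem conj_phase (θ : ℝ) : conj (phase θ) = phase (-θ) := by
  simp [phase, ← Complex.exp_conj]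

theorem continuous_phase : Continuous phase := by
  unfold phase
  fun_prop

variable {q : ℕ} [NeZero q]

/-- The fibre space of the Bloch decomposition: sequences over one period, with the norm of `ℓ²`. -/
abbrev Fiber (q : ℕ) : Type := EuclideanSpace ℂ (ZMod q)

/-- Translation by `k` in the fibre at quasimomentum `θ`: `p ↦ e^{iθk} p(· + k)`. -/
def twistedShift (θ : ℝ) (k : ℤ) : Fiber q →L[ℂ] Fiber q :=
  phase (θ * k) • (LinearIsometryEquiv.piLpCongrLeft 2 ℂ ℂ
    (Equiv.subRight (k : ZMod q))).toContinuousLinearEquiv.toContinuousLinearMap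

theorem twistedShift_apply (θ : ℝ) (k : ℤ) (p : Fiber q) (m : ZMod q) :
    twistedShift θ k p m = phase (θ * k) * p (m + k) := rfl

theorem norm_twistedShift_le (θ : ℝ) (k : ℤ) : ‖twistedShift (q := q) θ k‖ ≤ 1 := by
  refine ContinuousLinearMap.opNorm_le_bound _ zero_le_one fun p => ?_
  rw [twistedShift, smul_apply, norm_smul, norm_phase]
  exact mul_le_mul_of_nonneg_left (LinearIsometryEquiv.norm_map _ p).le zero_le_one

theorem star_twistedShift (θ : ℝ) (k : ℤ) :
    star (twistedShift (q := q) θ k) = twistedShift θ (-k) := by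
  rw [ContinuousLinearMap.star_eq_adjoint, eq_comm, ContinuousLinearMap.eq_adjoint_iff]
  intro x y
  rw [PiLp.inner_apply, PiLp.inner_apply, ← Equiv.sum_comp (Equiv.addRight (k : ZMod q))]
  refine Finset.sum_congr rfl fun m _ => ?_
  simp only [Equiv.coe_addRight, RCLike.inner_apply, twistedShift_apply, map_mul, conj_phase,
    Int.cast_neg, mul_neg, neg_neg, add_neg_cancel_right]
  ring

/-- Multiplication by a real function on one period. -/
def fiberDiag (c : ZMod q → ℝ) : Fiber q →L[ℂ] Fiber q :=
  Matrix.toEuclideanCLM (n := ZMod q) (𝕜 := ℂ) (Matrix.diagonal fun m => (c m : ℂ))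

theorem fiberDiag_apply (c : ZMod q → ℝ) (p : Fiber q) (m : ZMod q) :
    fiberDiag c p m = (c m : ℂ) * p m := by
  simp [fiberDiag, Matrix.mulVec_diagonal]

theorem norm_fiberDiag_le {R : ℝ} (hR : 0 ≤ R) {c : ZMod q → ℝ} (hc : ∀ m, |c m| ≤ R) :
    ‖fiberDiag c‖ ≤ R := by
  rw [fiberDiag, Matrix.l2_opNorm_toEuclideanCLM, Matrix.l2_opNorm_diagonal]
  exact (pi_norm_le_iff_of_nonneg hR).2 fun m => by simpa using hc m

theorem isSelfAdjoint_fiberDiag (c : ZMod q → ℝ) : IsSelfAdjoint (fiberDiag c) := by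
  rw [fiberDiag, IsSelfAdjoint, ← map_star, Matrix.star_eq_conjTranspose,
    Matrix.diagonal_conjTranspose]
  congr
  ext m
  simp

/-- The fibre of a `q`-periodic Jacobi operator at quasimomentum `θ`. -/
def fiberJacobi (a b : ZMod q → ℝ) (θ : ℝ) : Fiber q →L[ℂ] Fiber q :=
  jacobiForm (twistedShift θ 1) (twistedShift θ (-1)) (fiberDiag a) (fiberDiag b)

/-- The fibre of the velocity operator of a `q`-periodic Jacobi operator at quasimomentum `θ`. -/
def fiberVelocity (a : ZMod q → ℝ) (θ : ℝ) : Fiber q →L[ℂ] Fiber q :=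
  velocityForm (twistedShift θ 1) (twistedShift θ (-1)) (fiberDiag a)

theorem fiberJacobi_apply (a b : ZMod q → ℝ) (θ : ℝ) (p : Fiber q) (m : ZMod q) :
    fiberJacobi a b θ p m = phase (-θ) * (a (m - 1) * p (m - 1)) + b m * p m
      + a m * (phase θ * p (m + 1)) := by
  simp [fiberJacobi, jacobiForm, twistedShift_apply, fiberDiag_apply, sub_eq_add_neg]

theorem isSelfAdjoint_fiberJacobi (a b : ZMod q → ℝ) (θ : ℝ) :
    IsSelfAdjoint (fiberJacobi a b θ) :=
  isSelfAdjoint_jacobiForm (star_twistedShift θ 1) (isSelfAdjoint_fiberDiag a)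
    (isSelfAdjoint_fiberDiag b)

variable {R : ℝ} {a b : ZMod q → ℝ}

theorem norm_fiberJacobi_le (h : HasBounds R a b) (θ : ℝ) : ‖fiberJacobi a b θ‖ ≤ 3 * R := by
  have hform := norm_jacobiForm_le (norm_twistedShift_le (q := q) θ 1) (norm_twistedShift_le θ (-1))
    (fiberDiag a) (fiberDiag b)
  rw [fiberJacobi]
  linarith [norm_fiberDiag_le h.pos.le h.abs_coeff_le, norm_fiberDiag_le h.pos.le h.abs_le]

theorem norm_fiberVelocity_le (h : HasBounds R a b) (θ : ℝ) : ‖fiberVelocity a θ‖ ≤ 2 * R :=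
  (norm_velocityForm_le (norm_twistedShift_le (q := q) θ 1) (norm_twistedShift_le θ (-1))
    (fiberDiag a)).trans <|
    mul_le_mul_of_nonneg_left (norm_fiberDiag_le h.pos.le h.abs_coeff_le) zero_le_two

end Fiber

section Bloch

open scoped InnerProductSpace

variable {q : ℕ} [NeZero q]

/-- The Bloch transform at quasimomentum `θ`, whose value at `m` is
`∑_{n ≡ m mod q} e^{-iθn} ψ_n`. -/
def bloch (θ : ℝ) : ℓ¹(ℤ, ℂ) →L[ℂ] Fiber q :=
  lpOneLift (w := fun n : ℤ => EuclideanSpace.single (n : ZMod q) (phase (-(θ * n)))) (C := 1)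
    fun n => by rw [PiLp.norm_single, norm_phase]

theorem bloch_single (θ : ℝ) (n : ℤ) :
    bloch θ (lp.single 1 n 1) = EuclideanSpace.single (n : ZMod q) (phase (-(θ * n))) :=
  lpOneLift_single _ n

theorem norm_bloch_single (θ : ℝ) (n : ℤ) : ‖bloch (q := q) θ (lp.single 1 n 1)‖ = 1 := by
  rw [bloch_single, PiLp.norm_single, norm_phase]

theorem semiconj_bloch_shift (θ : ℝ) (k : ℤ) :
    Function.Semiconj (bloch (q := q) θ) (shiftL1 k) (twistedShift θ k) :=
  semiconj_of_single fun n => by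
    have hphase : phase (-(θ * ((n - k : ℤ) : ℝ))) = phase (θ * k) * phase (-(θ * n)) := by
      rw [← phase_add]
      congr 1
      push_cast
      ring
    ext m
    rw [shiftL1, lpOneLift_single, bloch_single, bloch_single, twistedShift_apply, hphase]
    simp [eq_sub_iff_add_eq]

theorem semiconj_bloch_diag (θ : ℝ) {c : ℓ^∞(ℤ, ℝ)} {c' : ZMod q → ℝ} (hc : ∀ n : ℤ, c n = c' n) :
    Function.Semiconj (bloch θ) (diagL1 c) (fiberDiag c') :=
  semiconj_of_single fun n => by
    ext m
    rw [diagL1, lpOneLift_single, map_smul, bloch_single, fiberDiag_apply, hc]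
    obtain rfl | hm := eq_or_ne m n <;> simp [*]

variable {a b : ℓ^∞(ℤ, ℝ)} {a' b' : ZMod q → ℝ}

theorem semiconj_bloch_timeAverage (ha : ∀ n : ℤ, a n = a' n) (hb : ∀ n : ℤ, b n = b' n)
    (θ t : ℝ) :
    Function.Semiconj (bloch θ) ⇑(timeAverage (jacobiL1 a b) (velocityL1 a) t)
      ⇑(timeAverage (fiberJacobi a' b' θ) (fiberVelocity a' θ) t) :=
  semiconj_timeAverage
    (semiconj_jacobiForm (semiconj_bloch_shift θ 1) (semiconj_bloch_shift θ (-1))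
      (semiconj_bloch_diag θ ha) (semiconj_bloch_diag θ hb))
    (semiconj_velocityForm (semiconj_bloch_shift θ 1) (semiconj_bloch_shift θ (-1))
      (semiconj_bloch_diag θ ha)) t

end Bloch

section Parseval

open ComplexConjugate MeasureTheory
open scoped InnerProductSpace

section OrthogonalFamily

variable {ι X F : Type*} [TopologicalSpace X] [NormedAddCommGroup F] [InnerProductSpace ℂ F]
  [CompleteSpace F] {w : X → ι → F} {C : ℝ} (hw : ∀ x n, ‖w x n‖ ≤ C)
  (hwc : ∀ n, Continuous fun x => w x n)

include hwc

omit [InnerProductSpace ℂ F] in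
theorem continuous_lpOneLift_apply [NormedSpace ℂ F] (ψ : ℓ¹(ι, ℂ)) :
    Continuous fun x => lpOneLift (hw x) ψ :=
  continuous_tsum (fun n => (hwc n).const_smul (ψ n)) ((summable_norm_lpOne ψ).mul_left C)
    fun n x => norm_smul_le_of_bounded (hw x) (ψ n) n

variable [MeasurableSpace X] [OpensMeasurableSpace X] [Countable ι] {μ : Measure X}
  [IsFiniteMeasure μ]

theorem hasSum_integral_inner_lpOneLift {g : X → F} (hg : Continuous g) {D : ℝ}
    (hgD : ∀ x, ‖g x‖ ≤ D) (ψ : ℓ¹(ι, ℂ)) :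
    HasSum (fun n => ψ n * ∫ x, ⟪g x, w x n⟫_ℂ ∂μ) (∫ x, ⟪g x, lpOneLift (hw x) ψ⟫_ℂ ∂μ) := by
  have hbound (n : ι) (x : X) : ‖ψ n * ⟪g x, w x n⟫_ℂ‖ ≤ ‖ψ n‖ * (D * C) := by
    rw [norm_mul]
    exact mul_le_mul_of_nonneg_left ((norm_inner_le_norm _ _).trans <|
      mul_le_mul (hgD x) (hw x n) (norm_nonneg _) ((norm_nonneg _).trans (hgD x))) (norm_nonneg _)
  have hpoint (x : X) :
      HasSum (fun n => ψ n * ⟪g x, w x n⟫_ℂ) ⟪g x, lpOneLift (hw x) ψ⟫_ℂ := by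
    rw [lpOneLift_apply]
    simpa only [innerSL_apply_apply, inner_smul_right] using
      (summable_norm_smul_of_bounded (hw x) ψ).of_norm.hasSum.mapL (innerSL ℂ (g x))
  simp only [← integral_const_mul]
  exact hasSum_integral_of_dominated_convergence (fun n _ => ‖ψ n‖ * (D * C))
    (fun n => (continuous_const.mul (hg.inner (hwc n))).aestronglyMeasurable)
    (fun n => .of_forall (hbound n)) (.of_forall fun _ => (summable_norm_lpOne ψ).mul_right _)
    (integrable_const _) (.of_forall hpoint)

theorem integral_norm_lpOneLift_sq [DecidableEq ι] {L : ℝ}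
    (horth : ∀ m n, ∫ x, ⟪w x m, w x n⟫_ℂ ∂μ = if m = n then (L : ℂ) else 0) (ψ : ℓ¹(ι, ℂ)) :
    ∫ x, ‖lpOneLift (hw x) ψ‖ ^ 2 ∂μ = L * ∑' n, ‖ψ n‖ ^ 2 := by
  set f : X → F := fun x => lpOneLift (hw x) ψ
  have hcoeff (m : ι) : ∫ x, ⟪w x m, f x⟫_ℂ ∂μ = ψ m * L := by
    refine (hasSum_integral_inner_lpOneLift hw hwc (hwc m) (fun x => hw x m) ψ).unique ?_
    have hsingle := hasSum_ite_eq m (ψ m * (L : ℂ))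
    refine hsingle.congr_fun fun n => ?_
    rw [horth]
    obtain rfl | hmn := eq_or_ne m n <;> simp [*, Ne.symm]
  have hcoeff_conj (n : ι) : ψ n * ∫ x, ⟪f x, w x n⟫_ℂ ∂μ = ((L * ‖ψ n‖ ^ 2 : ℝ) : ℂ) := by
    simp only [← inner_conj_symm (f _), integral_conj, hcoeff, map_mul, Complex.conj_ofReal]
    rw [← mul_assoc, Complex.mul_conj']
    push_cast
    ring
  have hsum := hasSum_integral_inner_lpOneLift (μ := μ) hw hwc
    (continuous_lpOneLift_apply hw hwc ψ) (fun x => norm_lpOneLift_apply_le (hw x) ψ) ψ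
  have hnorm (x : X) : ⟪f x, f x⟫_ℂ = ((‖f x‖ ^ 2 : ℝ) : ℂ) := by
    rw [inner_self_eq_norm_sq_to_K]
    norm_cast
  rw [funext hcoeff_conj, funext hnorm, integral_complex_ofReal, Complex.hasSum_ofReal] at hsum
  rw [← tsum_mul_left, hsum.tsum_eq]

end OrthogonalFamily

theorem integral_phase_mul_int (j : ℤ) :
    ∫ θ in (0 : ℝ)..(2 * Real.pi), phase (θ * j)
      = if j = 0 then ((2 * Real.pi : ℝ) : ℂ) else 0 := by
  split_ifs with hj
  · simp [hj]
  · have hc : Complex.I * (j : ℂ) ≠ 0 := mul_ne_zero Complex.I_ne_zero (Int.cast_ne_zero.2 hj)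
    have hphase (θ : ℝ) : phase (θ * j) = Complex.exp (Complex.I * (j : ℂ) * θ) := by
      rw [phase]
      push_cast
      ring_nf
    have hperiod : Complex.exp (Complex.I * (j : ℂ) * ((2 * Real.pi : ℝ) : ℂ)) = 1 := by
      rw [← Complex.exp_int_mul_two_pi_mul_I j]
      congr 1
      push_cast
      ring
    simp only [hphase]
    rw [integral_exp_mul_complex hc, hperiod]
    simp

variable {q : ℕ} [NeZero q]

omit [NeZero q] in
theorem continuous_single_phase (n : ℤ) :
    Continuous fun θ : ℝ => (EuclideanSpace.single (n : ZMod q) (phase (-(θ * n))) : Fiber q) :=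
  (PiLp.continuous_toLp 2 _).comp
    ((continuous_single _).comp (continuous_phase.comp (by fun_prop)))

theorem integral_inner_single_phase (m n : ℤ) :
    ∫ θ in (0 : ℝ)..(2 * Real.pi),
      ⟪(EuclideanSpace.single (m : ZMod q) (phase (-(θ * m))) : Fiber q),
        EuclideanSpace.single (n : ZMod q) (phase (-(θ * n)))⟫_ℂ
      = if m = n then ((2 * Real.pi : ℝ) : ℂ) else 0 := by
  simp only [EuclideanSpace.inner_single_left, PiLp.single_apply, conj_phase, neg_neg]
  by_cases hmod : (m : ZMod q) = n
  · have hphase (θ : ℝ) : phase (θ * m) * phase (-(θ * n)) = phase (θ * ((m - n : ℤ) : ℝ)) := by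
      rw [← phase_add]
      congr 1
      push_cast
      ring
    simp only [if_pos hmod, hphase, integral_phase_mul_int, sub_eq_zero]
  · have hmn : m ≠ n := fun hmn => hmod (congrArg _ hmn)
    simp only [if_neg hmod, if_neg hmn, mul_zero, intervalIntegral.integral_zero]

theorem continuous_bloch (ψ : ℓ¹(ℤ, ℂ)) : Continuous fun θ => bloch (q := q) θ ψ :=
  continuous_lpOneLift_apply _ continuous_single_phase ψ

theorem integral_norm_bloch_sq (ψ : ℓ¹(ℤ, ℂ)) :
    ∫ θ in (0 : ℝ)..(2 * Real.pi), ‖bloch (q := q) θ ψ‖ ^ 2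
      = 2 * Real.pi * ‖inclusion ψ‖ ^ 2 := by
  have hnorm : ‖inclusion ψ‖ ^ 2 = ∑' n, ‖ψ n‖ ^ 2 := by
    simpa [inclusion_apply] using lp.norm_rpow_eq_tsum (p := 2) (by norm_num) (inclusion ψ)
  rw [hnorm, intervalIntegral.integral_of_le Real.two_pi_pos.le]
  refine integral_norm_lpOneLift_sq _ continuous_single_phase (fun m n => ?_) ψ
  rw [← intervalIntegral.integral_of_le Real.two_pi_pos.le, integral_inner_single_phase]

end Parseval

section LorentzIntegral

open Real

theorem continuous_lorentz {f : ℝ → ℝ} (hf : Continuous f) :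
    Continuous fun x => (1 + f x ^ 2)⁻¹ :=
  (continuous_const.add (hf.pow 2)).inv₀ fun _ =>
    (add_pos_of_pos_of_nonneg one_pos (sq_nonneg _)).ne'

theorem integral_comp_nat_mul_of_periodic {f : ℝ → ℝ} {T : ℝ} (hf : Continuous f)
    (hper : Function.Periodic f T) {n : ℕ} (hn : n ≠ 0) (x : ℝ) :
    ∫ θ in (0 : ℝ)..T, f (n * θ) = ∫ y in x..x + T, f y := by
  have hn' : (n : ℝ) ≠ 0 := Nat.cast_ne_zero.2 hn
  have hsum := hper.intervalIntegral_add_zsmul_eq n 0 fun _ _ => hf.intervalIntegrable _ _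
  simp only [zero_add, natCast_zsmul, nsmul_eq_mul] at hsum
  rw [intervalIntegral.integral_comp_mul_left f hn', mul_zero, smul_eq_mul, hsum,
    inv_mul_cancel_left₀ hn', hper.intervalIntegral_add_eq x 0, zero_add]

theorem integral_lorentz_linear_le {k : ℝ} (hk : 0 < k) (x y : ℝ) :
    ∫ z in x..y, (1 + (k * z) ^ 2)⁻¹ ≤ π / k := by
  rw [intervalIntegral.integral_comp_mul_left (fun z => (1 + z ^ 2)⁻¹) hk.ne',
    integral_inv_one_add_sq, smul_eq_mul, div_eq_inv_mul]
  refine mul_le_mul_of_nonneg_left ?_ (inv_nonneg.2 hk.le)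
  linarith [arctan_lt_pi_div_two (k * y), neg_pi_div_two_lt_arctan (k * x)]

theorem integral_lorentz_sin_le {c : ℝ} (hc : 0 < c) :
    ∫ x in (-(π / 2))..π / 2, (1 + (c * sin x) ^ 2)⁻¹ ≤ π ^ 2 / (2 * c) := by
  have hmono : ∀ x ∈ Set.Icc (-(π / 2)) (π / 2),
      (1 + (c * sin x) ^ 2)⁻¹ ≤ (1 + (2 * c / π * x) ^ 2)⁻¹ := by
    intro x hx
    refine inv_anti₀ (by positivity) (add_le_add_right (sq_le_sq.2 ?_) 1)
    calc |2 * c / π * x| = c * (2 / π * |x|) := by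
          rw [abs_mul, abs_of_pos (by positivity)]
          ring
      _ ≤ c * |sin x| := mul_le_mul_of_nonneg_left (mul_abs_le_abs_sin (abs_le.2 hx)) hc.le
      _ = |c * sin x| := by rw [abs_mul, abs_of_pos hc]
  calc ∫ x in (-(π / 2))..π / 2, (1 + (c * sin x) ^ 2)⁻¹
      ≤ ∫ x in (-(π / 2))..π / 2, (1 + (2 * c / π * x) ^ 2)⁻¹ :=
        intervalIntegral.integral_mono_on (by linarith [pi_pos])
          ((continuous_lorentz (by fun_prop)).intervalIntegrable _ _)
          ((continuous_lorentz (by fun_prop)).intervalIntegrable _ _) hmono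
    _ ≤ π / (2 * c / π) := integral_lorentz_linear_le (by positivity) _ _
    _ = π ^ 2 / (2 * c) := by field_simp

theorem integral_lorentz_sin_nat_mul_le {c : ℝ} (hc : 0 < c) {n : ℕ} (hn : n ≠ 0) :
    ∫ θ in (0 : ℝ)..2 * π, (1 + (c * sin (n * θ)) ^ 2)⁻¹ ≤ π ^ 2 / c := by
  set f : ℝ → ℝ := fun x => (1 + (c * sin x) ^ 2)⁻¹ with hf
  have hcont : Continuous f := continuous_lorentz (by fun_prop)
  have hper : Function.Periodic f π := fun x => by simp only [hf, sin_add_pi, mul_neg, neg_sq]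
  have hhalf (x : ℝ) : ∫ y in x..x + π, f y = ∫ y in (-(π / 2))..π / 2, f y := by
    rw [hper.intervalIntegral_add_eq x (-(π / 2))]
    congr 1
    ring
  calc ∫ θ in (0 : ℝ)..2 * π, f (n * θ)
      = ∫ y in (0 : ℝ)..0 + 2 * π, f y :=
        integral_comp_nat_mul_of_periodic hcont (hper.nat_mul 2) hn 0
    _ = (∫ y in (0 : ℝ)..0 + π, f y) + ∫ y in π..π + π, f y := by
        rw [zero_add, zero_add, two_mul, intervalIntegral.integral_add_adjacent_intervals] <;>
          exact hcont.intervalIntegrable _ _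
    _ = 2 * ∫ y in (-(π / 2))..π / 2, f y := by rw [hhalf, hhalf, two_mul]
    _ ≤ 2 * (π ^ 2 / (2 * c)) := mul_le_mul_of_nonneg_left (integral_lorentz_sin_le hc) zero_le_two
    _ = π ^ 2 / c := by field_simp

end LorentzIntegral

section Dephasing

open scoped InnerProductSpace

theorem norm_integral_exp_le {ω : ℝ} (hω : ω ≠ 0) (t : ℝ) :
    ‖∫ τ in (0 : ℝ)..t, Complex.exp (Complex.I * τ * ω)‖ ≤ 2 / |ω| := by
  have hω' : Complex.I * (ω : ℂ) ≠ 0 :=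
    mul_ne_zero Complex.I_ne_zero (Complex.ofReal_ne_zero.2 hω)
  have hphase (τ : ℝ) : ‖Complex.exp (Complex.I * ω * τ)‖ = 1 := by
    rw [mul_assoc, ← Complex.ofReal_mul, Complex.norm_exp_I_mul_ofReal]
  simp only [mul_right_comm Complex.I]
  rw [integral_exp_mul_complex hω', norm_div, norm_mul, Complex.norm_I, one_mul, Complex.norm_real,
    Real.norm_eq_abs]
  refine div_le_div_of_nonneg_right ((norm_sub_le _ _).trans_eq ?_) (abs_nonneg _)
  rw [hphase, hphase, one_add_one_eq_two]

variable {E : Type*} [NormedAddCommGroup E] [InnerProductSpace ℂ E]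

theorem norm_apply_le_of_norm_inner_le {ι : Type*} [Fintype ι] (v : OrthonormalBasis ι ℂ E)
    {M : E →L[ℂ] E} {β : ℝ} (hM : ∀ i j, ‖⟪v i, M (v j)⟫_ℂ‖ ≤ β) (x : E) :
    ‖M x‖ ≤ Fintype.card ι ^ 2 * β * ‖x‖ := by
  have hcolumn (j : ι) : ‖M (v j)‖ ≤ Fintype.card ι * β := by
    rw [← v.sum_repr' (M (v j)), ← nsmul_eq_mul, ← Finset.card_univ, ← Finset.sum_const]
    refine norm_sum_le_of_le _ fun i _ => ?_
    rw [norm_smul, v.norm_eq_one, mul_one]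
    exact hM i j
  have hexpand : M x = ∑ j, ⟪v j, x⟫_ℂ • M (v j) := by
    conv_lhs => rw [← v.sum_repr' x, map_sum]
    simp only [map_smul]
  have hterm (j : ι) : ‖⟪v j, x⟫_ℂ • M (v j)‖ ≤ ‖x‖ * (Fintype.card ι * β) := by
    rw [norm_smul]
    refine mul_le_mul ((norm_inner_le_norm _ _).trans_eq ?_) (hcolumn j) (norm_nonneg _)
      (norm_nonneg _)
    rw [v.norm_eq_one, one_mul]
  calc ‖M x‖ ≤ ∑ _j : ι, ‖x‖ * (Fintype.card ι * β) := by
        rw [hexpand]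
        exact norm_sum_le_of_le _ fun j _ => hterm j
    _ = Fintype.card ι ^ 2 * β * ‖x‖ := by
        rw [Finset.sum_const, Finset.card_univ, nsmul_eq_mul]
        ring

variable [CompleteSpace E] {J P : E →L[ℂ] E}

theorem norm_timeAverage_sub_le (hJ : IsSelfAdjoint J) (P : E →L[ℂ] E) (s t : ℝ) (x : E) :
    ‖timeAverage J P s x - timeAverage J P t x‖ ≤ 2 * ‖P‖ * ‖x‖ := by
  rw [← sub_apply]
  refine ContinuousLinearMap.le_of_opNorm_le _ ((norm_sub_le _ _).trans ?_) x
  rw [two_mul]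
  exact add_le_add (norm_timeAverage_le hJ P s) (norm_timeAverage_le hJ P t)

theorem inner_conjugated_eigenvector (hJ : IsSelfAdjoint J) {x y : E} {l m : ℝ}
    (hx : J x = (l : ℂ) • x) (hy : J y = (m : ℂ) • y) (τ : ℝ) :
    ⟪x, conjugated J P τ y⟫_ℂ
      = Complex.exp (Complex.I * τ * ((l - m : ℝ) : ℂ)) * ⟪x, P y⟫_ℂ := by
  have hadjoint : ContinuousLinearMap.adjoint (propagator J τ) = propagator J (-τ) := by
    rw [← ContinuousLinearMap.star_eq_adjoint, star_propagator hJ]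
  rw [conjugated, mul_apply_eq_comp, mul_apply_eq_comp, ← ContinuousLinearMap.adjoint_inner_left,
    hadjoint, propagator_eigenvector hx, propagator_eigenvector hy, map_smul, inner_smul_left,
    inner_smul_right, ← mul_assoc, ← Complex.exp_conj, ← Complex.exp_add]
  congr 2
  simp
  ring

theorem inner_timeAverage_eigenvector (hJ : IsSelfAdjoint J) {x y : E} {l m : ℝ}
    (hx : J x = (l : ℂ) • x) (hy : J y = (m : ℂ) • y) (t : ℝ) :
    ⟪x, timeAverage J P t y⟫_ℂ
      = t⁻¹ • (∫ τ in (0 : ℝ)..t, Complex.exp (Complex.I * τ * ((l - m : ℝ) : ℂ)))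
        * ⟪x, P y⟫_ℂ := by
  rw [timeAverage_apply, inner_smul_right_eq_smul, smul_mul_assoc,
    ← intervalIntegral.integral_mul_const, ← innerSL_apply_apply ℂ,
    ← ContinuousLinearMap.intervalIntegral_comp_comm _
      ((continuous_conjugated_apply J P y).intervalIntegrable _ _)]
  simp only [innerSL_apply_apply, inner_conjugated_eigenvector hJ hx hy]

theorem inner_timeAverage_eigenvector_self (hJ : IsSelfAdjoint J) {x y : E} {l : ℝ}
    (hx : J x = (l : ℂ) • x) (hy : J y = (l : ℂ) • y) {t : ℝ} (ht : t ≠ 0) :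
    ⟪x, timeAverage J P t y⟫_ℂ = ⟪x, P y⟫_ℂ := by
  rw [inner_timeAverage_eigenvector hJ hx hy]
  simp [ht]

theorem norm_inner_timeAverage_eigenvector_le (hJ : IsSelfAdjoint J) {x y : E} {l m : ℝ}
    (hx : J x = (l : ℂ) • x) (hy : J y = (m : ℂ) • y) (hlm : l ≠ m) {t : ℝ} (ht : 0 ≤ t) :
    ‖⟪x, timeAverage J P t y⟫_ℂ‖ ≤ 2 * ‖P‖ / (t * |l - m|) * (‖x‖ * ‖y‖) := by
  rw [inner_timeAverage_eigenvector hJ hx hy, norm_mul, norm_smul, norm_inv,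
    Real.norm_of_nonneg ht]
  calc t⁻¹ * ‖∫ τ in (0 : ℝ)..t, Complex.exp (Complex.I * τ * ((l - m : ℝ) : ℂ))‖ * ‖⟪x, P y⟫_ℂ‖
      ≤ t⁻¹ * (2 / |l - m|) * (‖x‖ * (‖P‖ * ‖y‖)) := by
        gcongr
        · exact norm_integral_exp_le (sub_ne_zero.2 hlm) t
        · exact (norm_inner_le_norm _ _).trans <|
            mul_le_mul_of_nonneg_left (P.le_opNorm y) (norm_nonneg x)
    _ = 2 * ‖P‖ / (t * |l - m|) * (‖x‖ * ‖y‖) := by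
        rw [div_eq_mul_inv, div_eq_mul_inv, mul_inv]
        ring

theorem norm_timeAverage_sub_le_of_gap {ι : Type*} [Fintype ι] (hJ : IsSelfAdjoint J)
    (v : OrthonormalBasis ι ℂ E) {e : ι → ℝ} (hv : ∀ i, J (v i) = (e i : ℂ) • v i) {g : ℝ}
    (hg : 0 < g) (hgap : ∀ i j, i ≠ j → g ≤ |e i - e j|) {s t : ℝ} (ht : 0 < t) (hst : t ≤ s)
    (x : E) :
    ‖timeAverage J P s x - timeAverage J P t x‖
      ≤ Fintype.card ι ^ 2 * (4 * ‖P‖ / (t * g)) * ‖x‖ := by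
  have hoff {r : ℝ} (hr : t ≤ r) {i j : ι} (hij : i ≠ j) :
      ‖⟪v i, timeAverage J P r (v j)⟫_ℂ‖ ≤ 2 * ‖P‖ / (t * g) := by
    have hr' : 0 ≤ r := ht.le.trans hr
    have hne : e i ≠ e j := fun h => (hg.trans_le (hgap i j hij)).ne' (by simp [h])
    refine (norm_inner_timeAverage_eigenvector_le hJ (hv i) (hv j) hne hr').trans ?_
    rw [v.norm_eq_one, v.norm_eq_one, one_mul, mul_one]
    gcongr
    exact hgap i j hij
  rw [← sub_apply]
  refine norm_apply_le_of_norm_inner_le v (fun i j => ?_) x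
  rw [sub_apply, inner_sub_right]
  obtain rfl | hij := eq_or_ne i j
  · rw [inner_timeAverage_eigenvector_self hJ (hv i) (hv i) (ht.trans_le hst).ne',
      inner_timeAverage_eigenvector_self hJ (hv i) (hv i) ht.ne', sub_self, norm_zero]
    positivity
  · calc ‖⟪v i, timeAverage J P s (v j)⟫_ℂ - ⟪v i, timeAverage J P t (v j)⟫_ℂ‖
        ≤ 2 * ‖P‖ / (t * g) + 2 * ‖P‖ / (t * g) :=
          (norm_sub_le _ _).trans (add_le_add (hoff hst hij) (hoff le_rfl hij))
      _ = 4 * ‖P‖ / (t * g) := by ring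

end Dephasing

section FiberEstimate

open ComplexConjugate
open scoped InnerProductSpace

variable {q : ℕ} [NeZero q]

theorem sum_range_zmod {M : Type*} [AddCommMonoid M] (f : ZMod q → M) :
    ∑ n ∈ Finset.range q, f ((n : ℤ) : ZMod q) = ∑ m, f m := by
  refine Finset.sum_nbij' (fun n => (n : ZMod q)) ZMod.val (fun _ _ => Finset.mem_univ _)
    (fun m _ => Finset.mem_range.2 (ZMod.val_lt m))
    (fun n hn => ZMod.val_cast_of_lt (Finset.mem_range.1 hn))
    (fun m _ => ZMod.natCast_zmod_val m) fun n _ => by rw [Int.cast_natCast]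

/-- The Bloch wave on `ℤ` with quasimomentum `θ` and profile `p`. -/
def blochWave (θ : ℝ) (p : Fiber q) (n : ℤ) : ℂ := phase (θ * n) * p (n : ZMod q)

omit [NeZero q] in
theorem norm_blochWave (θ : ℝ) (p : Fiber q) (n : ℤ) : ‖blochWave θ p n‖ = ‖p (n : ZMod q)‖ := by
  rw [blochWave, norm_mul, norm_phase, one_mul]

omit [NeZero q] in
theorem blochWave_add (θ : ℝ) (p : Fiber q) (n k : ℤ) :
    blochWave θ p (n + k) = phase (θ * n) * (phase (θ * k) * p ((n : ZMod q) + k)) := by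
  rw [blochWave, ← mul_assoc, ← phase_add]
  push_cast
  rw [mul_add]

theorem sum_norm_blochWave_sq (θ : ℝ) (p : Fiber q) :
    ∑ n ∈ Finset.range q, ‖blochWave θ p n‖ ^ 2 = ‖p‖ ^ 2 := by
  simp only [norm_blochWave]
  rw [sum_range_zmod fun m => ‖p m‖ ^ 2, EuclideanSpace.norm_sq_eq]

theorem sum_conj_blochWave_mul (θ : ℝ) (p r : Fiber q) :
    ∑ n ∈ Finset.range q, conj (blochWave θ r n) * blochWave θ p n = ⟪r, p⟫_ℂ := by
  have hterm (n : ℤ) : conj (blochWave θ r n) * blochWave θ p n = conj (r (n : ZMod q)) * p n := by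
    have hphase : conj (phase (θ * n)) * phase (θ * n) = 1 := by simp [Complex.conj_mul']
    rw [blochWave, blochWave, map_mul, mul_mul_mul_comm, hphase, one_mul]
  simp only [hterm]
  rw [sum_range_zmod fun m => conj (r m) * p m, PiLp.inner_apply]
  exact Finset.sum_congr rfl fun m _ => by rw [RCLike.inner_apply, mul_comm]

variable {R : ℝ} {a b : ZMod q → ℝ}

theorem residual_blochWave {θ l : ℝ} {p : Fiber q}
    (hp : fiberJacobi a b θ p = (l : ℂ) • p) (n : ℤ) :
    residual (a ∘ (↑)) (b ∘ (↑)) l (blochWave θ p) n = 0 := by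
  have hn := congrArg (fun r : Fiber q => r (n : ZMod q)) hp
  simp only [fiberJacobi_apply, PiLp.smul_apply, smul_eq_mul] at hn
  have hprev := blochWave_add θ p n (-1)
  have hnext := blochWave_add θ p n 1
  push_cast at hprev hnext
  rw [← sub_eq_add_neg, ← sub_eq_add_neg, mul_neg_one] at hprev
  rw [mul_one] at hnext
  rw [residual, hprev, hnext]
  simp only [Function.comp_apply, Int.cast_sub, Int.cast_one, blochWave]
  linear_combination phase (θ * n) * hn

theorem isBlochSolution_blochWave {θ l : ℝ} {p : Fiber q}
    (hp : fiberJacobi a b θ p = (l : ℂ) • p) (hp1 : ‖p‖ = 1) :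
    IsBlochSolution q (a ∘ (↑)) (b ∘ (↑)) (phase (q * θ)) l (blochWave θ p) where
  residual_eq_zero := residual_blochWave hp
  add_period n := by
    rw [blochWave_add, blochWave]
    simp [mul_comm, mul_left_comm]
  sum_norm_sq := by rw [sum_norm_blochWave_sq, hp1, one_pow]

theorem abs_eigenvalue_fiberJacobi_le (h : HasBounds R a b) {θ l : ℝ} {p : Fiber q}
    (hp : fiberJacobi a b θ p = (l : ℂ) • p) (hp1 : ‖p‖ = 1) : |l| ≤ 3 * R := by
  have hnorm := (fiberJacobi a b θ).le_of_opNorm_le (norm_fiberJacobi_le h θ) p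
  rwa [hp, norm_smul, Complex.norm_real, hp1, mul_one, mul_one] at hnorm

omit [NeZero q] in
theorem norm_phase_sq_sub_one (x : ℝ) : ‖phase x ^ 2 - 1‖ = 2 * |Real.sin x| := by
  have hsq : phase x ^ 2 = Complex.exp (Complex.I * ((2 * x : ℝ) : ℂ)) := by
    rw [sq, ← phase_add, ← two_mul, phase]
  rw [hsq, Complex.norm_exp_I_mul_ofReal_sub_one, mul_div_cancel_left₀ _ two_ne_zero, norm_mul,
    Real.norm_two, Real.norm_eq_abs]

theorem two_mul_abs_sin_le_gapConstant_mul (h : HasBounds R a b) {θ l m : ℝ} {x y : Fiber q}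
    (hx : fiberJacobi a b θ x = (l : ℂ) • x) (hy : fiberJacobi a b θ y = (m : ℂ) • y)
    (hx1 : ‖x‖ = 1) (hy1 : ‖y‖ = 1) (hxy : ⟪y, x⟫_ℂ = 0) :
    2 * |Real.sin (q * θ)| ≤ gapConstant R q * |l - m| := by
  rw [← norm_phase_sq_sub_one]
  exact norm_sq_sub_one_le_gapConstant_mul (h.comp (↑)) (fun n => by simp) (norm_phase _)
    (abs_eigenvalue_fiberJacobi_le h hx hx1) (abs_eigenvalue_fiberJacobi_le h hy hy1)
    (isBlochSolution_blochWave hx hx1) (isBlochSolution_blochWave hy hy1)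
    ((sum_conj_blochWave_mul θ x y).trans hxy)

/-- The scale `κ` in the fibrewise rate `1 / (1 + (t / κ · sin (qθ))²)`. -/
def dephasingScale (R : ℝ) (q : ℕ) : ℝ := q ^ 2 * gapConstant R q

theorem gapConstant_pos (hR : 0 < R) : 0 < gapConstant R q := by
  have hq : (0 : ℝ) < q := Nat.cast_pos.2 (NeZero.pos q)
  unfold gapConstant
  positivity

theorem dephasingScale_pos (hR : 0 < R) : 0 < dephasingScale R q :=
  mul_pos (pow_pos (Nat.cast_pos.2 (NeZero.pos q)) 2) (gapConstant_pos hR)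

theorem norm_timeAverage_fiber_sub_mul_sin_le (h : HasBounds R a b) (θ : ℝ) {s t : ℝ}
    (ht : 0 < t) (hst : t ≤ s) {x : Fiber q} (hx : ‖x‖ = 1) :
    ‖timeAverage (fiberJacobi a b θ) (fiberVelocity a θ) s x
        - timeAverage (fiberJacobi a b θ) (fiberVelocity a θ) t x‖ * (t * |Real.sin (q * θ)|)
      ≤ 4 * R * dephasingScale R q := by
  have hR := h.pos
  have hG := gapConstant_pos (q := q) hR
  have hscale := dephasingScale_pos (q := q) hR
  obtain hsin | hsin := (abs_nonneg (Real.sin (q * θ))).eq_or_lt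
  · rw [← hsin, mul_zero, mul_zero]
    positivity
  have hJ := isSelfAdjoint_fiberJacobi a b θ
  have hfinrank : Module.finrank ℂ (Fiber q) = q := by simp
  let v := hJ.isSymmetric.eigenvectorBasis hfinrank
  have hv := hJ.isSymmetric.apply_eigenvectorBasis hfinrank
  have hgap (i j : Fin q) (hij : i ≠ j) : 2 * |Real.sin (q * θ)| / gapConstant R q
      ≤ |hJ.isSymmetric.eigenvalues hfinrank i - hJ.isSymmetric.eigenvalues hfinrank j| := by
    rw [div_le_iff₀' hG]
    exact two_mul_abs_sin_le_gapConstant_mul h (hv i) (hv j) (v.norm_eq_one i) (v.norm_eq_one j)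
      (v.orthonormal.2 hij.symm)
  have hdephasing := norm_timeAverage_sub_le_of_gap (P := fiberVelocity a θ) hJ v hv
    (by positivity) hgap ht hst x
  rw [hx, mul_one, Fintype.card_fin] at hdephasing
  calc _ ≤ (q : ℝ) ^ 2 * (4 * ‖fiberVelocity a θ‖
          / (t * (2 * |Real.sin (q * θ)| / gapConstant R q))) * (t * |Real.sin (q * θ)|) :=
        mul_le_mul_of_nonneg_right hdephasing (by positivity)
    _ = 2 * ‖fiberVelocity a θ‖ * dephasingScale R q := by
        rw [dephasingScale]
        field_simp
        ring
    _ ≤ 2 * (2 * R) * dephasingScale R q := by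
        gcongr
        exact norm_fiberVelocity_le h θ
    _ = 4 * R * dephasingScale R q := by ring

theorem sq_le_two_mul_sq_mul_lorentz {y c C : ℝ} (hy : |y| ≤ C) (hyc : |y * c| ≤ C) :
    y ^ 2 ≤ 2 * C ^ 2 * (1 + c ^ 2)⁻¹ := by
  rw [← div_eq_mul_inv, le_div_iff₀ (by positivity), mul_one_add, ← mul_pow, two_mul]
  exact add_le_add (sq_le_sq.2 (hy.trans (le_abs_self C))) (sq_le_sq.2 (hyc.trans (le_abs_self C)))

theorem norm_timeAverage_fiber_sub_sq_le (h : HasBounds R a b) (θ : ℝ) {s t : ℝ}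
    (ht : 0 < t) (hst : t ≤ s) {x : Fiber q} (hx : ‖x‖ = 1) :
    ‖timeAverage (fiberJacobi a b θ) (fiberVelocity a θ) s x
        - timeAverage (fiberJacobi a b θ) (fiberVelocity a θ) t x‖ ^ 2
      ≤ 32 * R ^ 2 * (1 + (t / dephasingScale R q * Real.sin (q * θ)) ^ 2)⁻¹ := by
  have hscale := dephasingScale_pos (q := q) h.pos
  have hsin := norm_timeAverage_fiber_sub_mul_sin_le h θ ht hst hx
  have hbound := norm_timeAverage_sub_le (isSelfAdjoint_fiberJacobi a b θ) (fiberVelocity a θ) s t x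
  set y := ‖timeAverage (fiberJacobi a b θ) (fiberVelocity a θ) s x
    - timeAverage (fiberJacobi a b θ) (fiberVelocity a θ) t x‖ with hy
  have hy0 : 0 ≤ y := norm_nonneg _
  have hbounded : |y| ≤ 4 * R := by
    rw [abs_of_nonneg hy0]
    rw [hx, mul_one] at hbound
    linarith [norm_fiberVelocity_le h θ]
  have hdecay : |y * (t / dephasingScale R q * Real.sin (q * θ))| ≤ 4 * R := by
    rw [abs_mul, abs_mul, abs_of_nonneg hy0, abs_of_pos (div_pos ht hscale), div_mul_eq_mul_div,
      ← mul_div_assoc, div_le_iff₀ hscale]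
    exact hsin
  exact (sq_le_two_mul_sq_mul_lorentz hbounded hdecay).trans_eq (by ring)

end FiberEstimate

section LatticeEstimate

variable {R : ℝ} {q : ℕ} {a b : ℓ^∞(ℤ, ℝ)} {s t : ℝ}

theorem apply_zmod_val_of_periodic [NeZero q] {c : ℤ → ℝ} (hc : ∀ n, c (n + q) = c n) (n : ℤ) :
    c n = c (n : ZMod q).val := by
  have hper : Function.Periodic c (q : ℤ) := hc
  rw [ZMod.val_intCast, Int.emod_def, mul_comm]
  exact (hper.sub_int_mul_eq _).symm

theorem norm_velocity_le_of_hasBounds (h : HasBounds R a b) : ‖velocity a‖ ≤ 2 * R :=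
  (norm_velocity_le a).trans <|
    mul_le_mul_of_nonneg_left (lp.norm_le_of_forall_le h.pos.le h.abs_coeff_le) zero_le_two

theorem two_pi_mul_norm_timeAverage_single_sub_sq_le (h : HasBounds R a b)
    (hper : IsPeriodic q a b) (ht : 0 < t) (hst : t ≤ s) (n : ℤ) :
    2 * Real.pi * ‖timeAverage (jacobi a b) (velocity a) s (lp.single 2 n 1)
        - timeAverage (jacobi a b) (velocity a) t (lp.single 2 n 1)‖ ^ 2
      ≤ 32 * R ^ 2 * ∫ θ in (0 : ℝ)..(2 * Real.pi),
        (1 + (t / dephasingScale R q * Real.sin (q * θ)) ^ 2)⁻¹ := by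
  have : NeZero q := ⟨hper.1.ne'⟩
  let period (m : ZMod q) : ℤ := m.val
  set ψ : ℓ¹(ℤ, ℂ) := timeAverage (jacobiL1 a b) (velocityL1 a) s (lp.single 1 n 1)
    - timeAverage (jacobiL1 a b) (velocityL1 a) t (lp.single 1 n 1) with hψ
  have hinclusion (r : ℝ) := semiconj_timeAverage (semiconj_inclusion_jacobi a b)
    (semiconj_inclusion_velocity a) r
  have hbloch (θ r : ℝ) := semiconj_bloch_timeAverage (a' := a ∘ period) (b' := b ∘ period)
    (apply_zmod_val_of_periodic fun k => (hper.2 k).1)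
    (apply_zmod_val_of_periodic fun k => (hper.2 k).2) θ r
  rw [← inclusion_single, ← hinclusion s, ← hinclusion t, ← map_sub, ← hψ,
    ← integral_norm_bloch_sq (q := q), ← intervalIntegral.integral_const_mul]
  refine intervalIntegral.integral_mono_on Real.two_pi_pos.le
    (((continuous_bloch ψ).norm.pow 2).intervalIntegrable _ _)
    ((continuous_const.mul (continuous_lorentz (by fun_prop))).intervalIntegrable _ _)
    fun θ _ => ?_
  rw [hψ, map_sub, hbloch θ s, hbloch θ t]
  exact norm_timeAverage_fiber_sub_sq_le (h.comp period) θ ht hst (norm_bloch_single θ n)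

theorem norm_timeAverage_single_sub_sq_le (h : HasBounds R a b) (hper : IsPeriodic q a b)
    (ht : 0 < t) (hst : t ≤ s) (n : ℤ) :
    ‖timeAverage (jacobi a b) (velocity a) s (lp.single 2 n 1)
        - timeAverage (jacobi a b) (velocity a) t (lp.single 2 n 1)‖ ^ 2
      ≤ 64 * R ^ 2 * dephasingScale R q * t⁻¹ := by
  have : NeZero q := ⟨hper.1.ne'⟩
  have hscale := dephasingScale_pos (q := q) h.pos
  refine le_of_mul_le_mul_left ?_ Real.two_pi_pos
  calc _ ≤ 32 * R ^ 2 * (Real.pi ^ 2 / (t / dephasingScale R q)) :=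
        (two_pi_mul_norm_timeAverage_single_sub_sq_le h hper ht hst n).trans <|
          mul_le_mul_of_nonneg_left
            (integral_lorentz_sin_nat_mul_le (div_pos ht hscale) hper.1.ne') (by positivity)
    _ = Real.pi * (8 * Real.pi * (4 * R ^ 2 * dephasingScale R q * t⁻¹)) := by
        field_simp
        ring
    _ ≤ Real.pi * (8 * 4 * (4 * R ^ 2 * dephasingScale R q * t⁻¹)) := by
        gcongr
        exact Real.pi_le_four
    _ = 2 * Real.pi * (64 * R ^ 2 * dephasingScale R q * t⁻¹) := by ring

theorem one_le_dephasingScale (hR : 1 ≤ R) (hq : 0 < q) : 1 ≤ dephasingScale R q := by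
  have hq_sq : (1 : ℝ) ≤ q ^ 2 := one_le_pow₀ (Nat.one_le_cast.2 hq)
  have hbase : 1 ≤ 8 * R ^ 2 := by linarith [one_le_pow₀ hR (n := 2)]
  exact one_le_mul_of_one_le_of_one_le hq_sq <| one_le_mul_of_one_le_of_one_le
    (one_le_mul_of_one_le_of_one_le (by linarith) hq_sq) (one_le_pow₀ hbase)

theorem min_one_inv_le_rpow_neg_sq (ht : 0 < t) {α : ℝ} (hα : α ∈ Set.Icc (0 : ℝ) (1 / 2)) :
    min 1 t⁻¹ ≤ (t ^ (-α)) ^ 2 := by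
  obtain ht1 | ht1 := le_total 1 t
  · refine (min_le_right _ _).trans ?_
    rw [← Real.rpow_natCast, ← Real.rpow_mul ht.le, ← Real.rpow_neg_one]
    refine Real.rpow_le_rpow_of_exponent_le ht1 ?_
    push_cast
    linarith [hα.2]
  · exact (min_le_left _ _).trans <| one_le_pow₀ <|
      Real.one_le_rpow_of_pos_of_le_one_of_nonpos ht ht1 (neg_nonpos.2 hα.1)

theorem norm_timeAverage_single_sub_le (h : HasBounds R a b) (hper : IsPeriodic q a b) {α : ℝ}
    (hα : α ∈ Set.Icc (0 : ℝ) (1 / 2)) (ht : 0 < t) (hst : t ≤ s) (n : ℤ) :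
    ‖timeAverage (jacobi a b) (velocity a) s (lp.single 2 n 1)
        - timeAverage (jacobi a b) (velocity a) t (lp.single 2 n 1)‖
      ≤ 8 * R * dephasingScale R q * t ^ (-α) := by
  set D := ‖timeAverage (jacobi a b) (velocity a) s (lp.single 2 n 1)
    - timeAverage (jacobi a b) (velocity a) t (lp.single 2 n 1)‖
  have hR := h.pos
  have hscale := one_le_dephasingScale h.one_le hper.1
  have hD : D ≤ 4 * R := by
    have hsub := norm_timeAverage_sub_le (isSelfAdjoint_jacobi a b) (velocity a) s t
      (lp.single 2 n 1)
    rw [lp.norm_single (by norm_num), norm_one, mul_one] at hsub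
    linarith [norm_velocity_le_of_hasBounds h]
  have hbounded : D ^ 2 ≤ 64 * R ^ 2 * dephasingScale R q := by
    nlinarith [pow_le_pow_left₀ (norm_nonneg _) hD 2, sq_nonneg R]
  refine le_of_sq_le_sq ?_ (by positivity)
  calc D ^ 2 ≤ 64 * R ^ 2 * dephasingScale R q * min 1 t⁻¹ := by
        rw [mul_min_of_nonneg _ _ (by positivity), mul_one]
        exact le_min hbounded (norm_timeAverage_single_sub_sq_le h hper ht hst n)
    _ ≤ 64 * R ^ 2 * dephasingScale R q ^ 2 * (t ^ (-α)) ^ 2 := by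
        gcongr
        · exact le_self_pow₀ hscale two_ne_zero
        · exact min_one_inv_le_rpow_neg_sq ht hα
    _ = (8 * R * dephasingScale R q * t ^ (-α)) ^ 2 := by ring

theorem mul_dephasingScale_le_pow (hR : 1 ≤ R) (hq : 0 < q) :
    8 * R * dephasingScale R q ≤ (524288 * R ^ 8 + 2) ^ q := by
  have : 0 < R := zero_lt_one.trans_le hR
  have hq_le : (q : ℝ) ≤ 2 ^ q := by exact_mod_cast q.lt_two_pow_self.le
  have hR_le : 64 * R ^ 2 ≤ (64 * R ^ 2) ^ q :=
    le_self_pow₀ (by linarith [one_le_pow₀ hR (n := 2)]) hq.ne'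
  calc 8 * R * dephasingScale R q = 64 * R ^ 2 * (q : ℝ) ^ 4 * (8 * R ^ 2) ^ (3 * q) := by
        rw [dephasingScale, gapConstant]
        ring
    _ ≤ (64 * R ^ 2) ^ q * (2 ^ q) ^ 4 * (8 * R ^ 2) ^ (3 * q) := by gcongr
    _ = (64 * R ^ 2 * 2 ^ 4 * (8 * R ^ 2) ^ 3) ^ q := by
        rw [pow_mul _ 3 q, pow_right_comm, ← mul_pow, ← mul_pow]
    _ ≤ (524288 * R ^ 8 + 2) ^ q := by
        gcongr
        linarith

end LatticeEstimate

section Coefficients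

variable (a b : ℓ^∞(ℤ, ℝ))

theorem norm_jacobi_single_apply_le (m n : ℤ) :
    ‖jacobi a b (lp.single 2 m 1) n‖ ≤ ‖jacobi a b‖ := by
  refine (lp.norm_apply_le_norm two_ne_zero _ n).trans
    ((jacobi a b).le_of_opNorm_le_of_le le_rfl ?_ |>.trans (mul_one _).le)
  rw [lp.norm_single (by norm_num), norm_one]

theorem abs_offDiag_le_norm_jacobi (n : ℤ) : |a n| ≤ ‖jacobi a b‖ := by
  have hne : n - 1 ≠ n + 1 := by lia
  simpa [jacobi_apply, lp.single_apply, hne] using norm_jacobi_single_apply_le a b (n + 1) n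

theorem abs_diag_le_norm_jacobi (n : ℤ) : |b n| ≤ ‖jacobi a b‖ := by
  simpa [jacobi_apply, lp.single_apply] using norm_jacobi_single_apply_le a b n n

variable {a b} {R : ℝ}

theorem InClass.hasBounds (h : InClass R a b) : HasBounds R a b := by
  have hbdd : BddBelow (Set.range a) :=
    ⟨-‖a‖, Set.forall_mem_range.2 fun n =>
      (abs_le.1 (lp.norm_apply_le_norm ENNReal.top_ne_zero a n)).1⟩
  have ha_le (n : ℤ) : a n ≤ R :=
    (le_abs_self _).trans ((abs_offDiag_le_norm_jacobi a b n).trans h.norm_le)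
  have inv_le_a (n : ℤ) : R⁻¹ ≤ a n := h.inv_le_iInf.trans (ciInf_le hbdd n)
  have hR : 0 < R := h.iInf_pos.trans_le ((ciInf_le hbdd 0).trans (ha_le 0))
  have one_le_R : 1 ≤ R := by
    by_contra! hlt
    exact (((inv_le_a 0).trans (ha_le 0)).trans_lt hlt).not_ge ((one_le_inv₀ hR).2 hlt.le)
  exact ⟨one_le_R, inv_le_a, ha_le, fun n => (abs_diag_le_norm_jacobi a b n).trans h.norm_le⟩

end Coefficients

section PositionDomain

theorem norm_le_inv_sq_add_sq {n : ℤ} (hn : n ≠ 0) (z : ℂ) :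
    ‖z‖ ≤ 1 / (n : ℝ) ^ 2 + ‖(n : ℂ) * z‖ ^ 2 := by
  have hn_abs : 0 < |(n : ℝ)| := abs_pos.2 (Int.cast_ne_zero.2 hn)
  have hprod : ‖z‖ = 1 / |(n : ℝ)| * ‖(n : ℂ) * z‖ := by
    rw [norm_mul, Complex.norm_intCast]
    field_simp
  have hsq : 1 / (n : ℝ) ^ 2 = (1 / |(n : ℝ)|) ^ 2 := by rw [div_pow, one_pow, sq_abs]
  rw [hsq, hprod]
  nlinarith [two_mul_le_add_sq (1 / |(n : ℝ)|) ‖(n : ℂ) * z‖,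
    mul_nonneg (one_div_nonneg.2 hn_abs.le) (norm_nonneg ((n : ℂ) * z))]

theorem summable_norm_of_mem_position_domain {φ : H} (hφ : φ ∈ position.domain) :
    Summable fun n => ‖φ n‖ := by
  have hposition : Summable fun n : ℤ => ‖(n : ℂ) * φ n‖ ^ 2 := by
    simpa using (memℓp_gen_iff (p := 2) (by norm_num)).1 hφ
  refine .of_norm_bounded_eventually
    ((Real.summable_one_div_int_pow.2 one_lt_two).add hposition) ?_
  filter_upwards [(Set.finite_singleton (0 : ℤ)).compl_mem_cofinite] with n hn
  simpa using norm_le_inv_sq_add_sq hn (φ n)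

end PositionDomain

section StrongConvergence

section NormedSpace

variable {𝕜 E F α : Type*} [NontriviallyNormedField 𝕜] [NormedAddCommGroup E] [NormedSpace 𝕜 E]
  [NormedAddCommGroup F] [NormedSpace 𝕜 F] {A : α → E →L[𝕜] F} {l : Filter α}

/-- The vectors on which a family of bounded operators converges along a filter. -/
def convergenceSubmodule (A : α → E →L[𝕜] F) (l : Filter α) : Submodule 𝕜 E where
  carrier := {x | ∃ y, Tendsto (fun i => A i x) l (𝓝 y)}
  add_mem' := fun ⟨y, hy⟩ ⟨z, hz⟩ => ⟨y + z, by simpa using hy.add hz⟩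
  zero_mem' := ⟨0, by simpa using tendsto_const_nhds⟩
  smul_mem' := fun c _ ⟨y, hy⟩ => ⟨c • y, by simpa using hy.const_smul c⟩

variable [CompleteSpace F] [l.NeBot]

theorem isClosed_convergenceSubmodule (hA : Bornology.IsBounded (Set.range A)) :
    IsClosed (convergenceSubmodule A l : Set E) := by
  obtain ⟨C, hC, hAC⟩ := hA.exists_pos_norm_le
  refine isClosed_of_closure_subset fun x hx => cauchy_map_iff_exists_tendsto.1 <|
    Metric.cauchy_iff.2 ⟨inferInstance, fun ε hε => ?_⟩
  obtain ⟨x', ⟨y, hy⟩, hxx'⟩ := Metric.mem_closure_iff.1 hx (ε / (4 * C)) (by positivity)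
  have hnear (i : α) : dist (A i x) (A i x') ≤ ε / 4 := by
    rw [dist_eq_norm, ← map_sub]
    calc ‖A i (x - x')‖ ≤ C * (ε / (4 * C)) :=
          (A i).le_of_opNorm_le_of_le (hAC _ ⟨i, rfl⟩) (dist_eq_norm x x' ▸ hxx'.le)
      _ = ε / 4 := by field_simp
  refine ⟨Metric.ball y (ε / 2), ?_, fun u hu v hv => ?_⟩
  · rw [mem_map]
    filter_upwards [hy.eventually (Metric.ball_mem_nhds y (by positivity : 0 < ε / 4))] with i hi
    exact (dist_triangle _ (A i x') _).trans_lt (by linarith [hnear i, Metric.mem_ball.1 hi])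
  · exact (dist_triangle_right u v y).trans_lt
      (by linarith [Metric.mem_ball.1 hu, Metric.mem_ball.1 hv])

theorem exists_forall_tendsto_of_dense_span (hA : Bornology.IsBounded (Set.range A)) {s : Set E}
    (hs : Dense (Submodule.span 𝕜 s : Set E))
    (hlim : ∀ x ∈ s, ∃ y, Tendsto (fun i => A i x) l (𝓝 y)) :
    ∃ Q : E →L[𝕜] F, ∀ x, Tendsto (fun i => A i x) l (𝓝 (Q x)) := by
  have hspan : Submodule.span 𝕜 s ≤ convergenceSubmodule A l := Submodule.span_le.2 hlim
  choose Q hQ using fun x => (isClosed_convergenceSubmodule hA).closure_subset_iff.2 hspan (hs x)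
  exact ⟨.ofTendstoOfBoundedRange Q A (tendsto_pi_nhds.2 hQ) hA, hQ⟩

end NormedSpace

theorem isSelfAdjoint_of_forall_tendsto {𝕜 E α : Type*} [RCLike 𝕜] [NormedAddCommGroup E]
    [InnerProductSpace 𝕜 E] [CompleteSpace E] {A : α → E →L[𝕜] E} {l : Filter α} [l.NeBot]
    {Q : E →L[𝕜] E} (hA : ∀ i, IsSelfAdjoint (A i))
    (hQ : ∀ x, Tendsto (fun i => A i x) l (𝓝 (Q x))) : IsSelfAdjoint Q := by
  refine ContinuousLinearMap.isSelfAdjoint_iff_isSymmetric.2 fun x y => ?_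
  have hleft := (hQ x).inner (𝕜 := 𝕜) (tendsto_const_nhds (x := y))
  exact tendsto_nhds_unique
    (hleft.congr fun i => (hA i).isSymmetric x y) (tendsto_const_nhds.inner (hQ y))

section Sequences

variable {ι F : Type*} {p : ℝ≥0∞} [Fact (1 ≤ p)] [DecidableEq ι] [NormedAddCommGroup F]
  [NormedSpace ℂ F]

theorem hasSum_smul_single (hp : p ≠ ∞) (φ : lp (fun _ : ι => ℂ) p) :
    HasSum (fun n => φ n • (lp.single p n 1 : lp (fun _ : ι => ℂ) p)) φ := by
  simpa only [← lp.single_smul, smul_eq_mul, mul_one] using lp.hasSum_single hp φ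

theorem dense_span_range_single (hp : p ≠ ∞) :
    Dense (Submodule.span ℂ (Set.range fun n : ι => (lp.single p n 1 : lp (fun _ : ι => ℂ) p)) :
      Set (lp (fun _ : ι => ℂ) p)) := fun φ =>
  mem_closure_of_tendsto (hasSum_smul_single hp φ) <| .of_forall fun _ =>
    Submodule.sum_smul_mem _ _ fun n _ => Submodule.subset_span ⟨n, rfl⟩

theorem norm_apply_le_of_single (hp : p ≠ ∞) {T : lp (fun _ : ι => ℂ) p →L[ℂ] F} {C : ℝ}
    (hT : ∀ n, ‖T (lp.single p n 1)‖ ≤ C) {φ : lp (fun _ : ι => ℂ) p}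
    (hφ : Summable fun n => ‖φ n‖) : ‖T φ‖ ≤ C * ∑' n, ‖φ n‖ := by
  rw [← (T.hasSum (hasSum_smul_single hp φ)).tsum_eq]
  refine tsum_of_norm_bounded (hφ.hasSum.mul_left C) fun n => ?_
  rw [map_smul]
  exact norm_smul_le_of_bounded hT (φ n) n

end Sequences

end StrongConvergence

section AsymptoticVelocity

variable {R t : ℝ} {q : ℕ} {a b : ℓ^∞(ℤ, ℝ)} {J Q Q' : H →L[ℂ] H}

theorem exists_tendsto_timeAverage_single (h : HasBounds R a b) (hper : IsPeriodic q a b) (n : ℤ) :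
    ∃ y, Tendsto (fun t => timeAverage (jacobi a b) (velocity a) t (lp.single 2 n 1)) atTop
      (𝓝 y) := by
  have hrate : Tendsto (fun t : ℝ => 8 * R * dephasingScale R q * t ^ (-(1 / 2) : ℝ)) atTop
      (𝓝 0) := by
    simpa using (tendsto_rpow_neg_atTop one_half_pos).const_mul (8 * R * dephasingScale R q)
  refine cauchySeq_tendsto_of_complete <| Metric.cauchySeq_iff'.2 fun ε hε => ?_
  obtain ⟨t, htε, ht⟩ := ((hrate.eventually_lt_const hε).and (eventually_gt_atTop 0)).exists
  refine ⟨t, fun s hst => ?_⟩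
  rw [dist_eq_norm]
  exact (norm_timeAverage_single_sub_le h hper ⟨by norm_num, le_rfl⟩ ht hst n).trans_lt htε

theorem exists_isSelfAdjoint_tendsto_timeAverage (h : HasBounds R a b) (hper : IsPeriodic q a b) :
    ∃ Q : H →L[ℂ] H, IsSelfAdjoint Q ∧
      ∀ φ, Tendsto (fun t => timeAverage (jacobi a b) (velocity a) t φ) atTop (𝓝 (Q φ)) := by
  have hJ := isSelfAdjoint_jacobi a b
  have hbounded : Bornology.IsBounded (Set.range (timeAverage (jacobi a b) (velocity a))) :=
    isBounded_iff_forall_norm_le.2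
      ⟨‖velocity a‖, Set.forall_mem_range.2 (norm_timeAverage_le hJ (velocity a))⟩
  obtain ⟨Q, hQ⟩ := exists_forall_tendsto_of_dense_span hbounded
    (dense_span_range_single ENNReal.ofNat_ne_top)
    (Set.forall_mem_range.2 (exists_tendsto_timeAverage_single h hper))
  exact ⟨Q, isSelfAdjoint_of_forall_tendsto
    (isSelfAdjoint_timeAverage hJ (isSelfAdjoint_velocity a)) hQ, hQ⟩

theorem norm_limit_sub_timeAverage_le (h : HasBounds R a b) (hper : IsPeriodic q a b)
    (hQ : ∀ φ, Tendsto (fun t => timeAverage (jacobi a b) (velocity a) t φ) atTop (𝓝 (Q φ)))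
    {α : ℝ} (hα : α ∈ Set.Icc (0 : ℝ) (1 / 2)) (ht : 0 < t) {φ : H}
    (hφ : Summable fun n => ‖φ n‖) :
    ‖Q φ - timeAverage (jacobi a b) (velocity a) t φ‖
      ≤ 8 * R * dephasingScale R q * t ^ (-α) * ∑' n, ‖φ n‖ := by
  refine norm_apply_le_of_single (T := Q - timeAverage (jacobi a b) (velocity a) t)
    ENNReal.ofNat_ne_top (fun n => ?_) hφ
  refine le_of_tendsto ((hQ _).sub_const _).norm ?_
  filter_upwards [eventually_ge_atTop t] with s hst
  exact norm_timeAverage_single_sub_le h hper hα ht hst n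

theorem norm_sub_heisenberg_le (a b : ℓ^∞(ℤ, ℝ)) (y : H) (φ : position.domain) (ht : 0 ≤ t) :
    ∃ hφ : (φ : H) ∈ (heisenberg (jacobi a b) t).domain,
      ‖y - ((t⁻¹ : ℝ) : ℂ) • heisenberg (jacobi a b) t ⟨φ, hφ⟩‖
        ≤ t⁻¹ * ‖position φ‖ + ‖y - timeAverage (jacobi a b) (velocity a) t φ‖ := by
  obtain ⟨hφ, hheisenberg⟩ := heisenberg_eq_position_add_timeAverage a b φ t
  refine ⟨hφ, ?_⟩
  rw [hheisenberg, sub_add_eq_sub_sub_swap]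
  refine (norm_sub_le _ _).trans_eq ?_
  rw [norm_smul, Complex.norm_real, Real.norm_of_nonneg (inv_nonneg.2 ht), add_comm]

theorem isAsymptoticVelocity_of_tendsto (hQ : IsSelfAdjoint Q)
    (hlim : ∀ φ, Tendsto (fun t => timeAverage (jacobi a b) (velocity a) t φ) atTop (𝓝 (Q φ))) :
    IsAsymptoticVelocity (jacobi a b) Q := by
  refine ⟨hQ, fun φ hφ => ?_⟩
  choose hdomain hheisenberg using heisenberg_eq_position_add_timeAverage a b ⟨φ, hφ⟩
  have hposition : Tendsto (fun t : ℝ => ((t⁻¹ : ℝ) : ℂ) • position ⟨φ, hφ⟩) atTop (𝓝 0) := by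
    simpa using ((Complex.continuous_ofReal.tendsto 0).comp tendsto_inv_atTop_zero).smul_const
      (position ⟨φ, hφ⟩)
  refine ⟨hdomain, ?_⟩
  simpa only [hheisenberg, zero_add] using hposition.add (hlim φ)

theorem IsAsymptoticVelocity.eqOn (h : IsAsymptoticVelocity J Q) (h' : IsAsymptoticVelocity J Q') :
    Set.EqOn Q Q' position.domain := fun φ hφ =>
  tendsto_nhds_unique (h.2 φ hφ).choose_spec (h'.2 φ hφ).choose_spec

theorem IsAsymptoticVelocity.asymptoticVelocity (h : IsAsymptoticVelocity J Q) :
    IsAsymptoticVelocity J (asymptoticVelocity J) := by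
  have hexists : ∃ Q, IsAsymptoticVelocity J Q := ⟨Q, h⟩
  rw [JacobiTransport.asymptoticVelocity, dif_pos hexists]
  exact hexists.choose_spec

end AsymptoticVelocity

end JacobiTransport

end

theorem mainTheorem5_general (R : ℝ) :
    ∃ C₁ : ℝ, 1 < C₁ ∧ ∀ α ∈ Set.Icc (0 : ℝ) (1 / 2),
      ∀ (q : ℕ) (a b : ℓ^∞(ℤ, ℝ)), InClass R a b → IsPeriodic q a b →
        IsAsymptoticVelocity (jacobi a b) (asymptoticVelocity (jacobi a b)) ∧
        ∀ (φ : H) (hφ : φ ∈ position.domain),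
          Summable (fun n : ℤ => ‖φ n‖) ∧
          ∀ t : ℝ, 0 < t →
            ∃ ht : φ ∈ (heisenberg (jacobi a b) t).domain,
              ‖asymptoticVelocity (jacobi a b) φ
                  - ((t⁻¹ : ℝ) : ℂ) • heisenberg (jacobi a b) t ⟨φ, ht⟩‖
                ≤ t⁻¹ * ‖position ⟨φ, hφ⟩‖
                  + C₁ ^ q * (∑' n : ℤ, ‖φ n‖) * t ^ (-α) := by
  refine ⟨524288 * R ^ 8 + 2, by linarith [(by decide : Even 8).pow_nonneg R],
    fun α hα q a b h hper => ?_⟩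
  have hbounds := h.hasBounds
  obtain ⟨Q, hQ, hlim⟩ := exists_isSelfAdjoint_tendsto_timeAverage hbounds hper
  have hvelocity := isAsymptoticVelocity_of_tendsto hQ hlim
  refine ⟨hvelocity.asymptoticVelocity, fun φ hφ => ?_⟩
  have hsum := summable_norm_of_mem_position_domain hφ
  refine ⟨hsum, fun t ht => ?_⟩
  rw [hvelocity.asymptoticVelocity.eqOn hvelocity hφ]
  obtain ⟨htφ, hle⟩ := norm_sub_heisenberg_le a b (Q φ) ⟨φ, hφ⟩ ht.le
  refine ⟨htφ, hle.trans (add_le_add_right ?_ _)⟩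
  calc ‖Q φ - timeAverage (jacobi a b) (velocity a) t φ‖
      ≤ 8 * R * dephasingScale R q * t ^ (-α) * ∑' n, ‖φ n‖ :=
        norm_limit_sub_timeAverage_le hbounds hper hlim hα ht hsum
    _ ≤ (524288 * R ^ 8 + 2) ^ q * t ^ (-α) * ∑' n, ‖φ n‖ := by
        gcongr
        exact mul_dephasingScale_le_pow hbounds.one_le hper.1
    _ = (524288 * R ^ 8 + 2) ^ q * (∑' n, ‖φ n‖) * t ^ (-α) := mul_right_comm _ _ _

theorem mainTheorem5 (R : ℝ) (hR : 0 < R) :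
    ∃ C₁ : ℝ, 1 < C₁ ∧
      ∀ (q : ℕ) (a b : ℓ^∞(ℤ, ℝ)), InClass R a b → IsPeriodic q a b →
        IsAsymptoticVelocity (jacobi a b) (asymptoticVelocity (jacobi a b)) ∧
        ∀ (φ : H) (hφ : φ ∈ position.domain),
          Summable (fun n : ℤ => ‖φ n‖) ∧
          ∀ t : ℝ, 0 < t →
            ∃ ht : φ ∈ (heisenberg (jacobi a b) t).domain,
              ‖asymptoticVelocity (jacobi a b) φ
                  - ((t⁻¹ : ℝ) : ℂ) • heisenberg (jacobi a b) t ⟨φ, ht⟩‖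
                ≤ t⁻¹ * ‖position ⟨φ, hφ⟩‖
                  + C₁ ^ q * (∑' n : ℤ, ‖φ n‖) * t ^ (-(1 / 5) : ℝ) :=
  (mainTheorem5_general R).imp fun _ hC₁ => ⟨hC₁.1, hC₁.2 (1 / 5) ⟨by norm_num, by norm_num⟩⟩
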